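/- Let $(\Omega,\mathbb P)$ be a probability space and let $\{x_\alpha\}_{\alpha\in\mathbb Z}$ and $\{y_\alpha\}_{\alpha\in\mathbb Z}$ be two families of (real or complex) random variables on it, independent of each other, each of them i.i.d. with $\mathbb E x_\alpha=\mathbb E y_\alpha=0$, $\mathbb E|x_\alpha|^2=\mathbb E|y_\alpha|^2=1$ and, for every $1\le p<\infty$, $\sup_\alpha\mathbb E|x_\alpha|^p<\infty$ and $\sup_\alpha\mathbb E|y_\alpha|^p<\infty$. For $n\ge1$ let $X_n=(x_{i-j})_{1\le i,j\le n}$ (non-symmetric Toeplitz), $Y_n=(y_{i+j})_{1\le i,j\le n}$ (Hankel), and let $X_n\odot Y_n$ be their entrywise product, an element of the $*$-probability space $\bigl(\mathcal M_n(L^{\infty,-}(\Omega,\mathbb P)),\varphi_n\bigr)$ with $L^{\infty,-}=\bigcap_{1\le p<\infty}L^p$ and $\varphi_n=\frac1n\mathbb E\,\mathrm{tr}$. A circular variable in a $*$-probability space $(\mathcal A,\varphi)$ is an element $c=(s_1+is_2)/\sqrt2$ with $s_1,s_2$ freely independent and semi-circular (self-adjoint, with $\varphi(s^{2k})=\frac1{k+1}\binom{2k}{k}$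 and vanishing odd moments). Then $a_n=n^{-1/2}(X_n\odot Y_n)$ converges in $*$-distribution to a circular variable: circular variables exist, and for every circular variable $c$ in a $*$-probability space $(\mathcal A,\varphi)$ and every non-commutative polynomial $Q\in\mathbb C\langle X,X^*\rangle$, $$\varphi_n\bigl(Q(a_n,a_n^*)\bigr)\longrightarrow\varphi\bigl(Q(c,c^*)\bigr)\qquad(n\to\infty).$$ Moreover, for each $n\ge1$, the matrix $X_n\odot Y_n$ involves only $O(n)$ scalar random variables: exactly $2n-1$ of the $x_\alpha$ and $2n-1$ of the $y_\alpha$ occur, $4n-2$ in total. -/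

import Mathlib

open MeasureTheory ProbabilityTheory Filter Topology
open scoped ENNReal Matrix

noncomputable section

/-! ### Star-probability spaces, freeness, circular variables -/

namespace FreeProb

section Abstract

variable {A : Type*} [Ring A] [StarRing A] [Algebra ℂ A]

/-- A linear functional `φ` on a unital `*`-algebra is a (positive, normalised) state, i.e.
`(A, φ)` is a `*`-probability space. -/
structure IsStarState (φ : A →ₗ[ℂ] ℂ) : Prop where
  map_one : φ 1 = 1
  nonneg : ∀ a : A, 0 ≤ (φ (star a * a)).re ∧ (φ (star a * a)).im = 0

/-- Free independence of a family of unital subalgebras: `φ (a₁ ⋯ a_k) = 0` for every nonempty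
alternating word in centred elements. A letter is a pair (index of a subalgebra, element of it). -/
def FreeSubalgebras {A : Type*} [Ring A] [Algebra ℂ A] (φ : A →ₗ[ℂ] ℂ) {ι : Type*}
    (S : ι → Subalgebra ℂ A) : Prop :=
  ∀ w : List (ι × A), w ≠ [] →
    (∀ p ∈ w, p.2 ∈ S p.1) →
    (∀ p ∈ w, φ p.2 = 0) →
    w.IsChain (fun p q => p.1 ≠ q.1) →
    φ (w.map Prod.snd).prod = 0

/-- Free independence of elements: the unital subalgebras generated by each of them are free. -/
def FreeElements {A : Type*} [Ring A] [Algebra ℂ A] (φ : A →ₗ[ℂ] ℂ) {ι : Type*}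
    (a : ι → A) : Prop :=
  FreeSubalgebras φ (fun i => Algebra.adjoin ℂ {a i})

/-- Standard semi-circular element: self-adjoint, with the Catalan numbers as even moments. -/
structure IsSemicircular (φ : A →ₗ[ℂ] ℂ) (s : A) : Prop where
  selfAdjoint : IsSelfAdjoint s
  moments : ∀ k : ℕ, φ (s ^ k) = if Even k then (catalan (k / 2) : ℂ) else 0

/-- Circular element: `c = (s₁ + i s₂) / √2` with `s₁, s₂` free semi-circular elements. -/
def IsCircular (φ : A →ₗ[ℂ] ℂ) (c : A) : Prop :=
  ∃ s : Fin 2 → A, (∀ i, IsSemicircular φ (s i)) ∧ FreeElements φ s ∧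
    c = ((Real.sqrt 2 : ℝ) : ℂ)⁻¹ • (s 0 + Complex.I • s 1)

/-- The two non-commuting indeterminates `X` and `X*`. -/
inductive StarVar : Type
  | X
  | Xstar

/-- The `*`-distribution of `a`: the functional `Q ↦ φ (Q (a, a*))` on `ℂ⟨X, X*⟩`. -/
def starDistribution (φ : A →ₗ[ℂ] ℂ) (a : A) : FreeAlgebra ℂ StarVar →ₗ[ℂ] ℂ :=
  φ ∘ₗ (FreeAlgebra.lift ℂ
    (fun v : StarVar => match v with
      | StarVar.X => a
      | StarVar.Xstar => star a)).toLinearMap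

end Abstract

/-- Convergence in `*`-distribution of `aₙ ∈ (Bₙ, φₙ)` to `a ∈ (A, φ)`. -/
def ConvergesInStarDistribution {B : ℕ → Type*} [∀ n, Ring (B n)] [∀ n, StarRing (B n)]
    [∀ n, Algebra ℂ (B n)] (φB : ∀ n, B n →ₗ[ℂ] ℂ) (b : ∀ n, B n)
    {A : Type*} [Ring A] [StarRing A] [Algebra ℂ A] (φ : A →ₗ[ℂ] ℂ) (a : A) : Prop :=
  ∀ Q : FreeAlgebra ℂ StarVar,
    Tendsto (fun n => starDistribution (φB n) (b n) Q) atTop (𝓝 (starDistribution φ a Q))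

end FreeProb

/-! ### The `*`-algebra of random variables with all moments finite -/

namespace RandomMatrix

open FreeProb

variable {Ω : Type*} [MeasurableSpace Ω]

/-- Pointwise ring structure on almost-everywhere classes of complex random variables. -/
instance instCommRingAEEqFun (P : Measure Ω) : CommRing (Ω →ₘ[P] ℂ) :=
  { (inferInstance : AddCommGroup (Ω →ₘ[P] ℂ)), (inferInstance : CommMonoid (Ω →ₘ[P] ℂ)) with
    left_distrib := fun f g h => AEEqFun.toGerm_injective (by
      simp only [AEEqFun.mul_toGerm, AEEqFun.add_toGerm, mul_add])
    right_distrib := fun f g h => AEEqFun.toGerm_injective (by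
      simp only [AEEqFun.mul_toGerm, AEEqFun.add_toGerm, add_mul])
    zero_mul := fun f => AEEqFun.toGerm_injective (by
      simp only [AEEqFun.mul_toGerm, AEEqFun.zero_toGerm, zero_mul])
    mul_zero := fun f => AEEqFun.toGerm_injective (by
      simp only [AEEqFun.mul_toGerm, AEEqFun.zero_toGerm, mul_zero]) }

instance instAlgebraAEEqFun (P : Measure Ω) : Algebra ℂ (Ω →ₘ[P] ℂ) :=
  Algebra.ofModule
    (fun c f g => by
      ext
      filter_upwards [AEEqFun.coeFn_mul (c • f) g, AEEqFun.coeFn_smul c f,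
        AEEqFun.coeFn_smul c (f * g), AEEqFun.coeFn_mul f g] with ω h1 h2 h3 h4
      simp [h1, h2, h3, h4, mul_assoc])
    (fun c f g => by
      ext
      filter_upwards [AEEqFun.coeFn_mul f (c • g), AEEqFun.coeFn_smul c g,
        AEEqFun.coeFn_smul c (f * g), AEEqFun.coeFn_mul f g] with ω h1 h2 h3 h4
      simp [h1, h2, h3, h4, mul_left_comm])

/-- Hölder: if all moments of `f` and `g` are finite then so are those of `f * g`. -/
theorem memLp_mul_of_forall {P : Measure Ω} {f g : Ω → ℂ}
    (hf : ∀ p : ℝ≥0∞, 1 ≤ p → p ≠ ∞ → MemLp f p P)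
    (hg : ∀ p : ℝ≥0∞, 1 ≤ p → p ≠ ∞ → MemLp g p P) (p : ℝ≥0∞) (h1 : 1 ≤ p) (hp : p ≠ ∞) :
    MemLp (f * g) p P := by
  have h2 : (1 : ℝ≥0∞) ≤ 2 * p := le_trans h1 (le_mul_of_one_le_left zero_le (by norm_num))
  have h3 : 2 * p ≠ ∞ := ENNReal.mul_ne_top (by norm_num) hp
  have : ENNReal.HolderTriple (2 * p) (2 * p) p := ⟨by
    rw [ENNReal.mul_inv (by norm_num) (by norm_num), ← add_mul, ENNReal.inv_two_add_inv_two,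
      one_mul]⟩
  exact MemLp.mul (hg _ h2 h3) (hf _ h2 h3)

/-- `L^{∞,-}(Ω, P) = ⋂_{1 ≤ p < ∞} L^p(Ω, P)`, as a unital algebra of a.e.-classes. -/
def LInfMinus (P : Measure Ω) [IsProbabilityMeasure P] : Subalgebra ℂ (Ω →ₘ[P] ℂ) where
  carrier := {f | ∀ p : ℝ≥0∞, 1 ≤ p → p ≠ ∞ → MemLp f p P}
  mul_mem' {f g} hf hg p h1 hp :=
    (memLp_congr_ae (AEEqFun.coeFn_mul f g)).2 (memLp_mul_of_forall hf hg p h1 hp)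
  add_mem' {f g} hf hg p h1 hp :=
    (memLp_congr_ae (AEEqFun.coeFn_add f g)).2 ((hf p h1 hp).add (hg p h1 hp))
  algebraMap_mem' c p h1 hp := by
    have h : (algebraMap ℂ (Ω →ₘ[P] ℂ) c : Ω → ℂ) =ᵐ[P] fun _ => c := by
      rw [Algebra.algebraMap_eq_smul_one]
      filter_upwards [AEEqFun.coeFn_smul c (1 : Ω →ₘ[P] ℂ), AEEqFun.coeFn_one (α := Ω) (μ := P)
        (β := ℂ)] with ω h1 h2
      simp [h1, h2]
    exact (memLp_congr_ae h).2 (memLp_const c)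

/-- The `*`-operation on `L^{∞,-}` is pointwise complex conjugation. -/
instance instStarRingLInfMinus (P : Measure Ω) [IsProbabilityMeasure P] :
    StarRing (LInfMinus P) where
  star f := ⟨star f.1, fun p h1 hp =>
    (memLp_congr_ae (AEEqFun.coeFn_star f.1)).2 (f.2 p h1 hp).star⟩
  star_involutive f := Subtype.ext (star_star f.1)
  star_mul f g := Subtype.ext (AEEqFun.ext (by
    change ((star (f.1 * g.1) : Ω →ₘ[P] ℂ) : Ω → ℂ) =ᵐ[P] ((star g.1 * star f.1 : Ω →ₘ[P] ℂ))
    filter_upwards [AEEqFun.coeFn_star (f.1 * g.1), AEEqFun.coeFn_star f.1,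
      AEEqFun.coeFn_star g.1, AEEqFun.coeFn_mul f.1 g.1,
      AEEqFun.coeFn_mul (star g.1) (star f.1)] with ω h1 h2 h3 h4 h5
    rw [h1, Pi.star_apply, h4, h5, Pi.mul_apply, Pi.mul_apply, h2, h3, star_mul]
    rfl))
  star_add f g := Subtype.ext (AEEqFun.ext (by
    change ((star (f.1 + g.1) : Ω →ₘ[P] ℂ) : Ω → ℂ) =ᵐ[P] ((star f.1 + star g.1 : Ω →ₘ[P] ℂ))
    filter_upwards [AEEqFun.coeFn_star (f.1 + g.1), AEEqFun.coeFn_star f.1,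
      AEEqFun.coeFn_star g.1, AEEqFun.coeFn_add f.1 g.1,
      AEEqFun.coeFn_add (star f.1) (star g.1)] with ω h1 h2 h3 h4 h5
    rw [h1, Pi.star_apply, h4, h5, Pi.add_apply, Pi.add_apply, h2, h3, star_add]
    rfl))

instance instStarModuleLInfMinus (P : Measure Ω) [IsProbabilityMeasure P] :
    StarModule ℂ (LInfMinus P) where
  star_smul c f := Subtype.ext (AEEqFun.ext (by
    change ((star (c • f.1) : Ω →ₘ[P] ℂ) : Ω → ℂ) =ᵐ[P] ((star c • star f.1 : Ω →ₘ[P] ℂ))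
    filter_upwards [AEEqFun.coeFn_star (c • f.1), AEEqFun.coeFn_star f.1,
      AEEqFun.coeFn_smul c f.1, AEEqFun.coeFn_smul (star c) (star f.1)] with ω h1 h2 h3 h4
    rw [h1, Pi.star_apply, h3, h4, Pi.smul_apply, Pi.smul_apply, h2, star_smul]
    rfl))

theorem LInfMinus.integrable {P : Measure Ω} [IsProbabilityMeasure P] (f : LInfMinus P) :
    Integrable (f.1 : Ω → ℂ) P :=
  memLp_one_iff_integrable.1 (f.2 1 le_rfl ENNReal.one_ne_top)

/-- The class in `L^{∞,-}` of a random variable with all moments finite. -/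
def toLInfMinus (P : Measure Ω) [IsProbabilityMeasure P] (f : Ω → ℂ)
    (hf : ∀ p : ℝ≥0∞, 1 ≤ p → p ≠ ∞ → MemLp f p P) : LInfMinus P :=
  ⟨AEEqFun.mk f (hf 1 le_rfl ENNReal.one_ne_top).aestronglyMeasurable, fun p h1 hp =>
    (memLp_congr_ae (AEEqFun.coeFn_mk f _)).2 (hf p h1 hp)⟩

/-- Expectation on `L^{∞,-}`. -/
def expectation (P : Measure Ω) [IsProbabilityMeasure P] : LInfMinus P →ₗ[ℂ] ℂ where
  toFun f := ∫ ω, (f.1 : Ω → ℂ) ω ∂P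
  map_add' f g := by
    rw [← integral_add (LInfMinus.integrable f) (LInfMinus.integrable g)]
    exact integral_congr_ae (AEEqFun.coeFn_add f.1 g.1)
  map_smul' c f := by
    rw [RingHom.id_apply, ← integral_smul]
    exact integral_congr_ae (AEEqFun.coeFn_smul c f.1)

/-- The functional `(1/n) E tr` on the `*`-algebra `M_n(L^{∞,-}(Ω, P))`. -/
def normalizedTrace (P : Measure Ω) [IsProbabilityMeasure P] (n : ℕ) :
    Matrix (Fin n) (Fin n) (LInfMinus P) →ₗ[ℂ] ℂ :=
  (n : ℂ)⁻¹ • (expectation P ∘ₗ Matrix.traceLinearMap (Fin n) ℂ (LInfMinus P))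

theorem expectation_one (P : Measure Ω) [IsProbabilityMeasure P] : expectation P 1 = 1 := by
  have h : expectation P 1 = ∫ _, (1 : ℂ) ∂P :=
    integral_congr_ae (AEEqFun.coeFn_one (α := Ω) (μ := P) (β := ℂ))
  simpa using h

theorem expectation_star_mul_self (P : Measure Ω) [IsProbabilityMeasure P] (f : LInfMinus P) :
    expectation P (star f * f) = ((∫ ω, ‖(f.1 : Ω → ℂ) ω‖ ^ 2 ∂P : ℝ) : ℂ) := by
  rw [← integral_complex_ofReal]
  refine integral_congr_ae ?_
  change ((star f.1 * f.1 : Ω →ₘ[P] ℂ) : Ω → ℂ) =ᵐ[P] _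
  filter_upwards [AEEqFun.coeFn_mul (star f.1) f.1, AEEqFun.coeFn_star f.1] with ω h1 h2
  simp [h1, h2, Complex.conj_mul']

/-- For `n ≥ 1`, `(M_n(L^{∞,-}(Ω, P)), (1/n) E tr)` is a `*`-probability space. -/
theorem isStarState_normalizedTrace (P : Measure Ω) [IsProbabilityMeasure P] (n : ℕ)
    (hn : 1 ≤ n) : IsStarState (normalizedTrace P n) where
  map_one := by
    have : (n : ℂ) ≠ 0 := by exact_mod_cast (by omega : n ≠ 0)
    have h : expectation P ((n : ℕ) : LInfMinus P) = n := by
      rw [← nsmul_one, map_nsmul, expectation_one, nsmul_one]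
    simp [normalizedTrace, h, this]
  nonneg a := by
    have h : normalizedTrace P n (star a * a) =
        (((n : ℝ)⁻¹ * ∑ j, ∑ i, ∫ ω, ‖((a i j).1 : Ω → ℂ) ω‖ ^ 2 ∂P : ℝ) : ℂ) := by
      simp only [normalizedTrace, LinearMap.smul_apply, LinearMap.comp_apply,
        Matrix.traceLinearMap_apply, Matrix.trace, Matrix.diag_apply, Matrix.mul_apply,
        Matrix.star_apply, map_sum, expectation_star_mul_self, smul_eq_mul]
      push_cast
      rfl
    rw [h]
    refine ⟨?_, Complex.ofReal_im _⟩
    rw [Complex.ofReal_re]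
    exact mul_nonneg (by positivity) (Finset.sum_nonneg fun _ _ => Finset.sum_nonneg fun _ _ =>
      integral_nonneg fun _ => by positivity)

/-! ### Patterned random matrices -/

/-- Admissible input variables: i.i.d., mean zero, unit variance, and for each `1 ≤ p < ∞` the
`p`-th absolute moments bounded uniformly over the family. -/
structure IsInput (P : Measure Ω) (x : ℤ → Ω → ℂ) : Prop where
  measurable : ∀ α, Measurable (x α)
  indep : iIndepFun x P
  identDistrib : ∀ α β, IdentDistrib (x α) (x β) P P
  mean_zero : ∀ α, ∫ ω, x α ω ∂P = 0
  unit_variance : ∀ α, ∫ ω, ‖x α ω‖ ^ 2 ∂P = 1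
  moments : ∀ p : ℝ≥0∞, 1 ≤ p → p ≠ ∞ → ⨆ α, eLpNorm (x α) p P < ∞

theorem IsInput.memLp {P : Measure Ω} {x : ℤ → Ω → ℂ} (hx : IsInput P x) (α : ℤ)
    (p : ℝ≥0∞) (h1 : 1 ≤ p) (hp : p ≠ ∞) : MemLp (x α) p P :=
  ⟨(hx.measurable α).aestronglyMeasurable,
    lt_of_le_of_lt (le_iSup (fun α => eLpNorm (x α) p P) α) (hx.moments p h1 hp)⟩

/-- The `n × n` patterned matrix `(x_{L(i,j)})_{1 ≤ i, j ≤ n}`; rows and columns are numbered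
from `1`, whereas `Fin n` starts at `0`. -/
def patterned (P : Measure Ω) [IsProbabilityMeasure P] (x : ℤ → Ω → ℂ) (hx : IsInput P x)
    (L : ℕ → ℕ → ℤ) (n : ℕ) : Matrix (Fin n) (Fin n) (LInfMinus P) :=
  Matrix.of fun i j =>
    toLInfMinus P (x (L (i + 1) (j + 1))) (hx.memLp (L (i + 1) (j + 1)))

/-- Link function of the non-symmetric Toeplitz matrix. -/
def toeplitzLink (i j : ℕ) : ℤ := (i : ℤ) - (j : ℤ)

/-- Link function of the Hankel matrix. -/
def hankelLink (i j : ℕ) : ℤ := (i : ℤ) + (j : ℤ)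

/-- The indices of the input variables that occur in the `n × n` matrix with link function `L`. -/
def usedIndices (L : ℕ → ℕ → ℤ) (n : ℕ) : Finset ℤ :=
  (Finset.Icc 1 n ×ˢ Finset.Icc 1 n).image fun ij => L ij.1 ij.2

/-- `n^{-1/2} (X_n ⊙ Y_n)`, with `X_n` Toeplitz and `Y_n` Hankel. -/
def scaledProduct (P : Measure Ω) [IsProbabilityMeasure P] (x y : ℤ → Ω → ℂ)
    (hx : IsInput P x) (hy : IsInput P y) (n : ℕ) : Matrix (Fin n) (Fin n) (LInfMinus P) :=
  ((Real.sqrt n : ℝ) : ℂ)⁻¹ •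
    (patterned P x hx toeplitzLink n).hadamard (patterned P y hy hankelLink n)

end RandomMatrix

end

/-! The proof is the moment method. A `*`-moment of length `m` is `n ^ (-1 - m/2)` times a sum over
closed walks `p 0, …, p m = p 0` in `{1, …, n}`. Step `t` carries the Toeplitz label `± (p t - p
(t+1))`, with the minus sign for a starred letter, and the Hankel label `p t + p (t+1)`. The walk
moment factorizes into an `x`-moment and a `y`-moment, and vanishes if some label of either kind
occurs only once.

The starting vertex and the Toeplitz labels determine the walk. If every Toeplitz label repeats, at
most `m/2` of them are distinct. A walk with fewer distinct labels, or with a nontrivial linear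
relation between the distinct ones, has so few degrees of freedom that all such walks together
number `O(n ^ (1 + ⌊(m-1)/2⌋))`, which is negligible (`card_le_of_relationHolds`). For the others
the Toeplitz labels form a pairing. Closing the walk is a linear relation between labels, and its
triviality forces opposite letters in each pair. A coincidence of Hankel labels at `s < t` is
another relation, and its triviality forces `s, t` to be a pair whose interior is a union of pairs.
So both kinds of labels define the same noncrossing pairing, and the moment is `1`
(`exists_noncrossing_partner`, `walkMoment_eq_ncSum_or`).

The limit is identified through `ncSum (stepWeight w p)`, the number of noncrossing pairings that
match opposite letters traversing an edge in opposite directions. It agrees with the walk moment on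
every closed walk that is not negligible, and its sum over all walks is exactly `n ^ (1 + m/2)`
times the number of noncrossing pairings of opposite letters (`sum_mul_ncSum_stepWeight`). The same
number is the `*`-moment of a circular element on the full Fock space, by a Wick formula
(`map_prod_eq_ncSum`, `vacuum_prod_circ`). Freeness determines the joint distribution of two
semi-circular elements (`map_lift_eq_of_free`), so the result passes from this model to every
circular element. -/

noncomputable section

/-! ### Noncrossing Wick sums -/

namespace FreeProb

/-- The sum over noncrossing pairings of the positions `a, …, b - 1` of the products of the
weights `κ s t` of the pairs. -/
def ncSum {R : Type*} [CommSemiring R] (κ : ℕ → ℕ → R) (a b : ℕ) : R :=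
  if a < b then
    ∑ j : Finset.Ioo a b, κ a j * ncSum κ (a + 1) j * ncSum κ (j + 1) b
  else 1
termination_by b - a
decreasing_by
  all_goals
    have := Finset.mem_Ioo.1 j.2
    omega

section ncSum

variable {R : Type*} [CommSemiring R] (κ : ℕ → ℕ → R)

theorem ncSum_of_le {a b : ℕ} (h : b ≤ a) : ncSum κ a b = 1 := by
  rw [ncSum, if_neg (by omega)]

theorem ncSum_of_lt {a b : ℕ} (h : a < b) :
    ncSum κ a b = ∑ j ∈ Finset.Ico (a + 1) b, κ a j * ncSum κ (a + 1) j * ncSum κ (j + 1) b := by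
  rw [ncSum, if_pos h,
    Finset.sum_coe_sort (Finset.Ioo a b) fun j => κ a j * ncSum κ (a + 1) j * ncSum κ (j + 1) b]
  rfl

/-- A nonzero sum has a nonzero term, hence a pairing of the whole interval with all weights
nonzero. Its contrapositive kills the sum as soon as one position has no admissible partner. -/
theorem exists_partner_of_ncSum_ne_zero (r : ℕ → ℕ → Prop) (hr : ∀ s t, r s t → r t s)
    (hκ : ∀ s t, κ s t ≠ 0 → r s t) (a b : ℕ) (h : ncSum κ a b ≠ 0) (s : ℕ) (has : a ≤ s)
    (hsb : s < b) : ∃ t, a ≤ t ∧ t < b ∧ t ≠ s ∧ r s t := by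
  induction hL : b - a using Nat.strong_induction_on generalizing a b with
  | _ L ih =>
    rw [ncSum_of_lt κ (by omega)] at h
    obtain ⟨j, hj, hne⟩ := Finset.exists_ne_zero_of_sum_ne_zero h
    rw [Finset.mem_Ico] at hj
    have h1 : κ a j ≠ 0 := fun h0 => hne (by simp [h0])
    have h2 : ncSum κ (a + 1) j ≠ 0 := fun h0 => hne (by simp [h0])
    have h3 : ncSum κ (j + 1) b ≠ 0 := fun h0 => hne (by simp [h0])
    rcases Nat.lt_trichotomy s j with hs | hs | hs
    · rcases has.eq_or_lt with rfl | hs'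
      · exact ⟨j, by omega, by omega, by omega, hκ _ _ h1⟩
      · obtain ⟨t, t1, t2, t3, t4⟩ := ih (j - (a + 1)) (by omega) (a + 1) j h2 hs' hs rfl
        exact ⟨t, by omega, by omega, t3, t4⟩
    · subst hs
      exact ⟨a, by omega, by omega, by omega, hr _ _ (hκ _ _ h1)⟩
    · obtain ⟨t, t1, t2, t3, t4⟩ := ih (b - (j + 1)) (by omega) (j + 1) b h3 hs hsb rfl
      exact ⟨t, by omega, by omega, t3, t4⟩

/-- If the relation underlying the weights is a noncrossing pairing of the interval, then the
noncrossing sum has exactly one term. -/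
theorem ncSum_eq_one (r : ℕ → ℕ → Prop) (hr : ∀ s t, r s t → r t s) (m : ℕ)
    (h1 : ∀ s t, s < m → t < m → r s t → κ s t = 1)
    (h0 : ∀ s t, s < m → t < m → ¬ r s t → κ s t = 0)
    (huniq : ∀ s t t', s < m → t < m → t' < m → r s t → r s t' → t = t')
    (hirr : ∀ s, s < m → ¬ r s s)
    (hnc : ∀ s t u, s < u → u < t → t < m → r s t → ∃ v, s < v ∧ v < t ∧ r u v)
    (a b : ℕ) (hb : b ≤ m)
    (hex : ∀ s, a ≤ s → s < b → ∃ t, a ≤ t ∧ t < b ∧ r s t) : ncSum κ a b = 1 := by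
  induction hL : b - a using Nat.strong_induction_on generalizing a b with
  | _ L ih =>
    rcases le_or_gt b a with hab | hab
    · exact ncSum_of_le κ hab
    · obtain ⟨j, haj, hjb, hj⟩ := hex a le_rfl hab
      have hne : a ≠ j := fun h => hirr a (by omega) (h ▸ hj)
      rw [ncSum_of_lt κ hab, Finset.sum_eq_single j]
      · rw [h1 a j (by omega) (by omega) hj, ih (j - (a + 1)) (by omega) (a + 1) j (by omega) _ rfl,
          ih (b - (j + 1)) (by omega) (j + 1) b hb _ rfl]
        · simp
        -- The partner of a position beyond `j` cannot be `a` or `j`, which are taken, nor lie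
        -- between them: by `hnc` such a point already has its partner there.
        · intro s hs hsb
          obtain ⟨t, t1, t2, t3⟩ := hex s (by omega) hsb
          refine ⟨t, ?_, t2, t3⟩
          by_contra hlt
          rcases Nat.lt_trichotomy t j with h | h | h
          · rcases t1.eq_or_lt with rfl | h'
            · have := huniq _ _ _ (by omega) (by omega) (by omega) hj (hr _ _ t3)
              omega
            · obtain ⟨v, v1, v2, v3⟩ := hnc a j t h' h (by omega) hj
              have := huniq _ _ _ (by omega) (by omega) (by omega) v3 (hr _ _ t3)
              omega
          · subst h
            have := huniq _ _ _ (by omega) (by omega) (by omega) (hr _ _ hj) (hr _ _ t3)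
            omega
          · omega
        · intro s hs hsb
          obtain ⟨v, v1, v2, v3⟩ := hnc a j s (by omega) hsb (by omega) hj
          exact ⟨v, v1, v2, v3⟩
      · intro j' hj' hjj
        rw [Finset.mem_Ico] at hj'
        rw [h0 a j' (by omega) (by omega)
          (fun h => hjj (huniq _ _ _ (by omega) (by omega) (by omega) h hj)), zero_mul, zero_mul]
      · intro h
        exact (h (Finset.mem_Ico.2 ⟨by omega, hjb⟩)).elim

theorem norm_ncSum_le (κ : ℕ → ℕ → ℂ) (hκ : ∀ s t, ‖κ s t‖ ≤ 1) (a b : ℕ) :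
    ‖ncSum κ a b‖ ≤ ncSum (fun _ _ => (1 : ℝ)) a b := by
  induction hL : b - a using Nat.strong_induction_on generalizing a b with
  | _ L ih =>
    rcases le_or_gt b a with hab | hab
    · simp [ncSum_of_le _ hab]
    · rw [ncSum_of_lt _ hab, ncSum_of_lt _ hab]
      refine (norm_sum_le _ _).trans (Finset.sum_le_sum fun j hj => ?_)
      rw [Finset.mem_Ico] at hj
      rw [norm_mul, norm_mul]
      have h1 := ih (j - (a + 1)) (by omega) (a + 1) j rfl
      have h2 := ih (b - (j + 1)) (by omega) (j + 1) b rfl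
      have := hκ a j
      have h3 := (norm_nonneg _).trans h1
      gcongr

theorem ncSum_congr {κ κ' : ℕ → ℕ → R} (a b : ℕ)
    (h : ∀ s t, a ≤ s → s < t → t < b → κ s t = κ' s t) : ncSum κ a b = ncSum κ' a b := by
  induction hL : b - a using Nat.strong_induction_on generalizing a b with
  | _ L ih =>
    rcases le_or_gt b a with hab | hab
    · simp [ncSum_of_le _ hab]
    · rw [ncSum_of_lt _ hab, ncSum_of_lt _ hab]
      refine Finset.sum_congr rfl fun j hj => ?_
      rw [Finset.mem_Ico] at hj
      rw [h a j le_rfl (by omega) (by omega),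
        ih (j - (a + 1)) (by omega) (a + 1) j (fun s t h1 h2 h3 => h s t (by omega) h2 (by omega))
          rfl,
        ih (b - (j + 1)) (by omega) (j + 1) b (fun s t h1 h2 h3 => h s t (by omega) h2 (by omega))
          rfl]

/-- With all weights one, the noncrossing sum counts the noncrossing pairings. -/
theorem ncSum_one (L a : ℕ) :
    ncSum (fun _ _ => (1 : R)) a (a + L) = if Even L then (catalan (L / 2) : R) else 0 := by
  induction L using Nat.strong_induction_on generalizing a with
  | _ L ih =>
    rcases L with _ | L
    · simp [ncSum_of_le]
    · have key : ncSum (fun _ _ => (1 : R)) a (a + (L + 1)) = ∑ i ∈ Finset.range L,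
          (if Even i then (catalan (i / 2) : R) else 0) *
            (if Even (L - 1 - i) then (catalan ((L - 1 - i) / 2) : R) else 0) := by
        rw [ncSum_of_lt _ (by omega), Finset.sum_Ico_eq_sum_range]
        rw [show a + (L + 1) - (a + 1) = L by omega]
        refine Finset.sum_congr rfl fun i hi => ?_
        rw [Finset.mem_range] at hi
        rw [one_mul, ih i (by omega) (a + 1),
          show a + (L + 1) = (a + 1 + i + 1) + (L - 1 - i) by omega, ih (L - 1 - i) (by omega)]
      rw [key]
      rcases Nat.even_or_odd' L with ⟨k, rfl | rfl⟩
      · rw [if_neg (by simp)]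
        refine Finset.sum_eq_zero fun i hi => ?_
        rw [Finset.mem_range] at hi
        by_cases he : Even i
        · rw [if_neg (c := Even (2 * k - 1 - i)), mul_zero]
          rw [Nat.even_iff] at he ⊢
          omega
        · rw [if_neg he, zero_mul]
      · rw [if_pos (by rw [Nat.even_iff]; omega), show (2 * k + 1 + 1) / 2 = k + 1 by omega,
          catalan_succ, Fin.sum_univ_eq_sum_range (fun i => catalan i * catalan (k - i)) (k + 1)]
        -- Only first blocks of even length contribute; halving the index turns the sum into the
        -- Catalan recursion.
        have hsum : ∀ (g : ℕ → R) (k : ℕ), (∀ i, ¬ Even i → g i = 0) →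
            ∑ i ∈ Finset.range (2 * k + 1), g i = ∑ i ∈ Finset.range (k + 1), g (2 * i) := by
          intro g k hg
          induction k with
          | zero => simp
          | succ k ihk =>
            rw [Finset.sum_range_succ _ (k + 1), ← ihk, show 2 * (k + 1) + 1 = 2 * k + 1 + 1 + 1 by
              ring, Finset.sum_range_succ, Finset.sum_range_succ,
              hg (2 * k + 1) (by rw [Nat.even_iff]; omega), add_zero]
            rfl
        rw [hsum _ _ (fun i hi => by rw [if_neg hi, zero_mul])]
        push_cast
        refine Finset.sum_congr rfl fun i hi => ?_
        rw [Finset.mem_range] at hi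
        rw [if_pos (by simp), if_pos (by rw [Nat.even_iff]; omega)]
        congr 3 <;> omega

end ncSum

/-- Wick formula on a full Fock space: moments of sums of creation and annihilation operators with
respect to the vacuum state are noncrossing sums. -/
theorem map_prod_eq_ncSum {A : Type*} [Ring A] [Algebra ℂ A] (φ : A →ₗ[ℂ] ℂ) (h1 : φ 1 = 1)
    (p q : ℕ → A) (κ : ℕ → ℕ → ℂ) (hqp : ∀ s t, q s * p t = algebraMap ℂ A (κ s t))
    (hp : ∀ s x, φ (p s * x) = 0) (hq : ∀ s x, φ (x * q s) = 0) (L a : ℕ) :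
    φ ((List.range' a L).map (fun t => p t + q t)).prod = ncSum κ a (a + L) := by
  set W : ℕ → ℕ → A := fun a L => ((List.range' a L).map (fun t => p t + q t)).prod with hW
  have hW0 : ∀ a, W a 0 = 1 := fun a => by simp [hW]
  have hWs : ∀ a L, W a (L + 1) = (p a + q a) * W (a + 1) L := fun a L => by
    simp [hW, List.range'_succ]
  -- Here `q s` travels to the right until it is contracted with some `p j` (it dies at the end),
  -- and the letters passed on the way pair among themselves. The arbitrary left factor `x` lets the
  -- induction apply to `x * q s * q a`, moving `q a` first and `q s` afterwards.
  have key : ∀ L a s x, φ (x * q s * W a L) = ∑ j ∈ Finset.Ico a (a + L),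
      κ s j * ncSum κ a j * φ (x * W (j + 1) (a + L - (j + 1))) := by
    intro L
    induction L using Nat.strong_induction_on with
    | _ L ih =>
      intro a s x
      rcases L with _ | L
      · simp [hW0, hq]
      · have e1 : x * q s * W a (L + 1) =
            κ s a • (x * W (a + 1) L) + (x * q s) * q a * W (a + 1) L := by
          have e0 : x * q s * ((p a + q a) * W (a + 1) L) =
              x * (q s * p a) * W (a + 1) L + x * q s * q a * W (a + 1) L := by noncomm_ring
          rw [hWs, e0, hqp, Algebra.algebraMap_eq_smul_one]
          simp
        rw [e1, map_add, map_smul, ih L (by omega), Finset.sum_eq_sum_Ico_succ_bot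
          (by omega : a < a + (L + 1)), ncSum_of_le κ le_rfl]
        congr 1
        · rw [show a + (L + 1) - (a + 1) = L by omega, smul_eq_mul, mul_one]
        · rw [show a + 1 + L = a + (L + 1) by ring]
          have e2 : ∀ j ∈ Finset.Ico (a + 1) (a + (L + 1)),
              κ a j * ncSum κ (a + 1) j * φ (x * q s * W (j + 1) (a + (L + 1) - (j + 1))) =
              ∑ i ∈ Finset.Ico (j + 1) (a + (L + 1)), κ a j * ncSum κ (a + 1) j *
                (κ s i * ncSum κ (j + 1) i * φ (x * W (i + 1) (a + (L + 1) - (i + 1)))) := by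
            intro j hj
            rw [Finset.mem_Ico] at hj
            rw [ih (a + (L + 1) - (j + 1)) (by omega),
              show j + 1 + (a + (L + 1) - (j + 1)) = a + (L + 1) by omega, Finset.mul_sum]
          rw [Finset.sum_congr rfl e2, Finset.sum_Ico_Ico_comm']
          refine Finset.sum_congr rfl fun i hi => ?_
          rw [Finset.mem_Ico] at hi
          rw [ncSum_of_lt κ (by omega : a < i), Finset.mul_sum, Finset.sum_mul]
          refine Finset.sum_congr rfl fun j _ => ?_
          ring
  change φ (W a L) = _
  induction L using Nat.strong_induction_on generalizing a with
  | _ L ih =>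
    rcases L with _ | L
    · simp [hW0, h1, ncSum_of_le]
    · have := key L (a + 1) a 1
      rw [one_mul] at this
      rw [hWs, add_mul, map_add, hp, zero_add, this, ncSum_of_lt κ (by omega),
        show a + 1 + L = a + (L + 1) by ring]
      refine Finset.sum_congr rfl fun j hj => ?_
      rw [Finset.mem_Ico] at hj
      rw [one_mul, ih _ (by omega), show j + 1 + (a + (L + 1) - (j + 1)) = a + (L + 1) by omega]

end FreeProb

/-! ### The full Fock space over a two-dimensional space -/

namespace FreeProb

namespace Fock

open scoped InnerProductSpace

/-- The full Fock space over `ℂ²`, with orthonormal basis the words in two letters. -/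
abbrev Space : Type := lp (fun _ : List (Fin 2) => ℂ) 2

/-- The basis vector of a word. -/
def vec (w : List (Fin 2)) : Space := lp.single 2 w 1

theorem vec_apply (w u : List (Fin 2)) : (vec w : List (Fin 2) → ℂ) u = if u = w then 1 else 0 := by
  simp [vec, lp.single_apply, Pi.single_apply]

theorem inner_vec_left (w : List (Fin 2)) (v : Space) : ⟪vec w, v⟫_ℂ = v w := by
  simp [vec, lp.inner_single_left]

theorem orthonormal_vec : Orthonormal ℂ vec := by
  rw [orthonormal_iff_ite]
  intro i j
  rw [inner_vec_left, vec_apply]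

theorem ext_vec {S T : Space →L[ℂ] Space} (h : ∀ w, S (vec w) = T (vec w)) : S = T := by
  let b : HilbertBasis (List (Fin 2)) ℂ Space := ⟨LinearIsometryEquiv.refl ℂ _⟩
  have hb : ∀ w, b w = vec w := fun w => by
    rw [← HilbertBasis.repr_symm_single]
    rfl
  have hd : Dense (Submodule.span ℂ (Set.range b) : Set Space) := by
    rw [Submodule.dense_iff_topologicalClosure_eq_top]
    exact b.dense_span
  refine ContinuousLinearMap.ext_on hd ?_
  rintro _ ⟨w, rfl⟩
  rw [hb, h]

/-- The free creation operators. -/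
def creation (i : Fin 2) : Space →L[ℂ] Space :=
  (orthonormal_vec.comp (fun w => i :: w)
    (List.cons_injective)).orthogonalFamily.linearIsometry.toContinuousLinearMap

theorem creation_vec (i : Fin 2) (w : List (Fin 2)) : creation i (vec w) = vec (i :: w) := by
  rw [creation, LinearIsometry.coe_toContinuousLinearMap, vec,
    OrthogonalFamily.linearIsometry_apply_single]
  simp

theorem star_creation_apply (i : Fin 2) (v : Space) (w : List (Fin 2)) :
    (star (creation i) v : List (Fin 2) → ℂ) w = v (i :: w) := by
  rw [← inner_vec_left, ContinuousLinearMap.star_eq_adjoint, ContinuousLinearMap.adjoint_inner_right,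
    creation_vec, inner_vec_left]

theorem star_creation_vec_nil (i : Fin 2) : star (creation i) (vec []) = 0 := by
  ext w
  rw [star_creation_apply, vec_apply]
  simp

theorem star_creation_vec_cons (i j : Fin 2) (w : List (Fin 2)) :
    star (creation i) (vec (j :: w)) = if i = j then vec w else 0 := by
  ext u
  rw [star_creation_apply, vec_apply]
  by_cases h : i = j <;> simp [h, vec_apply]

theorem star_creation_mul_creation (i j : Fin 2) :
    star (creation i) * creation j = if i = j then 1 else 0 := by
  refine ext_vec fun w => ?_
  rw [mul_apply_eq_comp, creation_vec, star_creation_vec_cons]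
  by_cases h : i = j <;> simp [h]

/-- The vacuum state. -/
def vacuum : (Space →L[ℂ] Space) →ₗ[ℂ] ℂ where
  toFun T := (T (vec []) : List (Fin 2) → ℂ) []
  map_add' S T := by simp
  map_smul' c T := by simp

theorem vacuum_apply (T : Space →L[ℂ] Space) :
    vacuum T = (T (vec []) : List (Fin 2) → ℂ) [] := rfl

theorem vacuum_one : vacuum 1 = 1 := by
  rw [vacuum_apply]
  simp [vec_apply]

theorem isStarState_vacuum : IsStarState vacuum where
  map_one := vacuum_one
  nonneg T := by
    have h : vacuum (star T * T) = ((‖T (vec [])‖ ^ 2 : ℝ) : ℂ) := by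
      rw [vacuum_apply, ← inner_vec_left, mul_apply_eq_comp,
        ContinuousLinearMap.star_eq_adjoint, ContinuousLinearMap.adjoint_inner_right,
        inner_self_eq_norm_sq_to_K]
      norm_cast
    rw [h]
    exact ⟨by rw [Complex.ofReal_re]; positivity, Complex.ofReal_im _⟩

theorem vacuum_creation_mul (i : Fin 2) (T : Space →L[ℂ] Space) : vacuum (creation i * T) = 0 := by
  rw [vacuum_apply, ← inner_vec_left, mul_apply_eq_comp,
    ← ContinuousLinearMap.adjoint_inner_left, ← ContinuousLinearMap.star_eq_adjoint,
    star_creation_vec_nil, inner_zero_left]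

theorem vacuum_mul_star_creation (i : Fin 2) (T : Space →L[ℂ] Space) :
    vacuum (T * star (creation i)) = 0 := by
  rw [vacuum_apply, mul_apply_eq_comp, star_creation_vec_nil, map_zero]
  rfl

/-! ### Semi-circular elements on the Fock space and their freeness -/

/-- Sums of creation and annihilation operators. -/
def semicirc (i : Fin 2) : Space →L[ℂ] Space := creation i + star (creation i)

theorem isSemicircular_semicirc (i : Fin 2) : IsSemicircular vacuum (semicirc i) where
  selfAdjoint := by
    rw [isSelfAdjoint_iff, semicirc, star_add, star_star, add_comm]
  moments k := by
    have := map_prod_eq_ncSum vacuum vacuum_one (fun _ => creation i) (fun _ => star (creation i))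
      (fun _ _ => 1) (fun _ _ => by rw [star_creation_mul_creation]; simp)
      (fun _ => vacuum_creation_mul i) (fun _ => vacuum_mul_star_creation i) k 0
    rw [ncSum_one] at this
    rw [← this]
    simp [semicirc]

/-- The operator only sees the leading block of letters `i`: it moves the exponent up or down by
one, whatever `w` is. -/
theorem semicirc_replicate (i : Fin 2) (w : List (Fin 2)) (hw : w.head? ≠ some i) (n : ℕ) :
    semicirc i (vec (List.replicate n i ++ w)) = vec (List.replicate (n + 1) i ++ w) +
      if n = 0 then 0 else vec (List.replicate (n - 1) i ++ w) := by
  rw [semicirc, add_apply, creation_vec]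
  congr 1
  rcases n with _ | n
  · rcases w with _ | ⟨j, w⟩
    · simp [star_creation_vec_nil]
    · have : i ≠ j := fun h => hw (by simp [h])
      simp [star_creation_vec_cons, this]
  · simp [List.replicate_succ, star_creation_vec_cons]

/-- The point is that `c` does not depend on `w`, so it can be read off at the vacuum, where `c 0`
is the expectation of `T`. -/
theorem adjoin_semicirc_apply (i : Fin 2) {T : Space →L[ℂ] Space}
    (hT : T ∈ Algebra.adjoin ℂ {semicirc i}) : ∃ c : ℕ →₀ ℂ, ∀ w : List (Fin 2),
      w.head? ≠ some i →
        T (vec w) = Finsupp.linearCombination ℂ (fun n => vec (List.replicate n i ++ w)) c := by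
  rw [Algebra.adjoin_singleton_eq_range_aeval] at hT
  obtain ⟨Q, rfl⟩ := hT
  let J : (ℕ →₀ ℂ) →ₗ[ℂ] (ℕ →₀ ℂ) := Finsupp.linearCombination ℂ
    (fun n => Finsupp.single (n + 1) 1 + if n = 0 then 0 else Finsupp.single (n - 1) 1)
  have hJ : ∀ w : List (Fin 2), w.head? ≠ some i → ∀ c : ℕ →₀ ℂ,
      semicirc i (Finsupp.linearCombination ℂ (fun n => vec (List.replicate n i ++ w)) c) =
        Finsupp.linearCombination ℂ (fun n => vec (List.replicate n i ++ w)) (J c) := by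
    intro w hw c
    induction c using Finsupp.induction_linear with
    | zero => simp
    | add c d hc hd => simp only [map_add, hc, hd]
    | single n z =>
      simp only [J, Finsupp.linearCombination_single, map_smul, semicirc_replicate i w hw, map_add]
      split_ifs <;> simp
  change ∃ c : ℕ →₀ ℂ, ∀ w : List (Fin 2), w.head? ≠ some i → Polynomial.aeval (semicirc i) Q
    (vec w) = _
  induction Q using Polynomial.induction_on' with
  | add P Q hP hQ =>
    obtain ⟨c, hc⟩ := hP
    obtain ⟨d, hd⟩ := hQ
    exact ⟨c + d, fun w hw => by
      rw [map_add, add_apply, hc w hw, hd w hw, map_add]⟩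
  | monomial n z =>
    simp only [Polynomial.aeval_monomial]
    have : ∃ c : ℕ →₀ ℂ, ∀ w : List (Fin 2), w.head? ≠ some i → (semicirc i ^ n) (vec w) =
        Finsupp.linearCombination ℂ (fun n => vec (List.replicate n i ++ w)) c := by
      induction n with
      | zero => exact ⟨Finsupp.single 0 1, fun w _ => by simp⟩
      | succ n ih =>
        obtain ⟨c, hc⟩ := ih
        exact ⟨J c, fun w hw => by rw [pow_succ', mul_apply_eq_comp, hc w hw, hJ w hw]⟩
    obtain ⟨c, hc⟩ := this
    exact ⟨z • c, fun w hw => by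
      rw [← Algebra.smul_def, smul_apply, hc w hw, map_smul]⟩

/-- The span of the basis vectors of the words with first letter `i`. -/
def startsWith (i : Fin 2) : Submodule ℂ Space :=
  Submodule.span ℂ (Set.range fun w => vec (i :: w))

/-- Centring says that the coefficient `c 0` vanishes, so at least one letter `i` is put in front of
`w` in every remaining term. -/
theorem centred_apply_mem (i : Fin 2) {T : Space →L[ℂ] Space}
    (hT : T ∈ Algebra.adjoin ℂ {semicirc i}) (h0 : vacuum T = 0) (w : List (Fin 2))
    (hw : w.head? ≠ some i) : T (vec w) ∈ startsWith i := by
  obtain ⟨c, hc⟩ := adjoin_semicirc_apply i hT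
  have hc0 : c 0 = 0 := by
    have hlin : ∀ c : ℕ →₀ ℂ, (Finsupp.linearCombination ℂ
        (fun n => vec (List.replicate n i ++ [])) c : List (Fin 2) → ℂ) [] = c 0 := by
      intro c
      induction c using Finsupp.induction_linear with
      | zero => simp
      | add c d hc hd => simp only [map_add, lp.coeFn_add, Pi.add_apply, hc, hd, Finsupp.add_apply]
      | single n z =>
        rw [Finsupp.linearCombination_single, lp.coeFn_smul, Pi.smul_apply, vec_apply]
        rcases n with _ | n <;> simp [List.replicate_succ]
    rw [vacuum_apply, hc [] (by simp), hlin] at h0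
    exact h0
  rw [hc w hw, Finsupp.linearCombination_apply, Finsupp.sum]
  refine Submodule.sum_mem _ fun n _ => ?_
  rcases n with _ | n
  · rw [hc0, zero_smul]
    exact Submodule.zero_mem _
  · refine Submodule.smul_mem _ _ (Submodule.subset_span ⟨List.replicate n i ++ w, ?_⟩)
    simp [List.replicate_succ]

/-- Applied to the vacuum from right to left, each centred factor produces words starting with its
own index. The next factor has a different index, so `centred_apply_mem` applies again, and the
final vector has no component along the empty word. -/
theorem freeElements_semicirc : FreeElements vacuum semicirc := by
  intro w hne hmem hzero hchain
  have key : ∀ w : List (Fin 2 × (Space →L[ℂ] Space)),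
      (∀ p ∈ w, p.2 ∈ Algebra.adjoin ℂ {semicirc p.1}) → (∀ p ∈ w, vacuum p.2 = 0) →
      w.IsChain (fun p q => p.1 ≠ q.1) → ∀ p u, w = p :: u →
      (w.map Prod.snd).prod (vec []) ∈ startsWith p.1 := by
    intro w hmem hzero hchain
    induction w with
    | nil => simp
    | cons p u ih =>
      rintro p' u' h
      obtain ⟨rfl, rfl⟩ := List.cons.inj h
      rw [List.map_cons, List.prod_cons, mul_apply_eq_comp]
      rcases u with _ | ⟨q, u⟩
      · exact centred_apply_mem _ (hmem _ (by simp)) (hzero _ (by simp)) [] (by simp)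
      · have h1 := ih (fun x hx => hmem x (List.mem_cons_of_mem _ hx))
          (fun x hx => hzero x (List.mem_cons_of_mem _ hx)) hchain.tail q u rfl
        have hpq : p.1 ≠ q.1 := (List.isChain_cons_cons.1 hchain).1
        generalize (List.map Prod.snd (q :: u)).prod (vec []) = v at h1
        refine Submodule.span_induction ?_ ?_ ?_ ?_ h1
        · rintro _ ⟨x, rfl⟩
          exact centred_apply_mem _ (hmem _ (by simp)) (hzero _ (by simp)) _
            (by simpa using hpq.symm)
        · rw [map_zero]
          exact Submodule.zero_mem _
        · intro x y _ _ hx hy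
          rw [map_add]
          exact Submodule.add_mem _ hx hy
        · intro c x _ hx
          rw [map_smul]
          exact Submodule.smul_mem _ _ hx
  obtain ⟨p, u, rfl⟩ := List.exists_cons_of_ne_nil hne
  have h1 := key _ hmem hzero hchain p u rfl
  rw [vacuum_apply]
  refine Submodule.span_induction ?_ ?_ ?_ ?_ h1
  · rintro _ ⟨x, rfl⟩
    rw [vec_apply, if_neg (by simp)]
  · rfl
  · intro x y _ _ hx hy
    rw [lp.coeFn_add, Pi.add_apply, hx, hy, add_zero]
  · intro c x _ hx
    rw [lp.coeFn_smul, Pi.smul_apply, hx, smul_zero]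

/-- A circular element on the Fock space. -/
def circ : Space →L[ℂ] Space :=
  ((Real.sqrt 2 : ℝ) : ℂ)⁻¹ • (semicirc 0 + Complex.I • semicirc 1)

theorem isCircular_circ : IsCircular vacuum circ :=
  ⟨semicirc, isSemicircular_semicirc, freeElements_semicirc, rfl⟩

end Fock

/-- The sign of a letter: `1` for `X` and `-1` for `X*`. -/
def StarVar.sign : StarVar → ℤ
  | StarVar.X => 1
  | StarVar.Xstar => -1

/-- The evaluation of a letter at an element. -/
def StarVar.eval {A : Type*} [Star A] (a : A) : StarVar → A
  | StarVar.X => a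
  | StarVar.Xstar => star a

namespace Fock

/-- With `ε = ±1` the sign of a letter, its creation and annihilation parts have coefficients
proportional to `(1, ε i)`. Contracting two letters gives `(1 + (ε i)(ε' i)) / 2 = (1 - ε ε') / 2`,
which is `1` for opposite letters and `0` for equal ones. -/
theorem vacuum_prod_circ (w : ℕ → StarVar) (m : ℕ) :
    vacuum ((List.range m).map (fun t => (w t).eval circ)).prod =
      ncSum (fun s t => if (w s).sign + (w t).sign = 0 then 1 else 0) 0 m := by
  set r : ℂ := ((Real.sqrt 2 : ℝ) : ℂ)⁻¹ with hr
  have hrr : r * r = 2⁻¹ := by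
    rw [hr, ← mul_inv, ← Complex.ofReal_mul, Real.mul_self_sqrt (by norm_num)]
    norm_num
  have hrs : star r = r := by
    rw [hr, ← Complex.ofReal_inv]
    exact Complex.conj_ofReal _
  have h := map_prod_eq_ncSum vacuum vacuum_one
    (fun t => r • (creation 0 + ((w t).sign * Complex.I) • creation 1))
    (fun t => r • (star (creation 0) + ((w t).sign * Complex.I) • star (creation 1)))
    (fun s t => if (w s).sign + (w t).sign = 0 then 1 else 0) ?_ ?_ ?_ m 0
  · rw [zero_add] at h
    rw [← h, List.range_eq_range']
    congr 3
    funext t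
    rcases w t with _ | _
    · simp only [StarVar.eval, StarVar.sign, circ, semicirc, ← hr]
      module
    · simp only [StarVar.eval, StarVar.sign, circ, semicirc, ← hr, star_smul, star_add, star_star,
        hrs, Complex.star_def, Complex.conj_I]
      module
  · intro s t
    have e : ∀ a b : ℂ, r • (star (creation 0) + a • star (creation 1)) *
        r • (creation 0 + b • creation 1) = algebraMap ℂ _ ((1 + a * b) / 2) := by
      intro a b
      have h01 := star_creation_mul_creation 0 1
      have h10 := star_creation_mul_creation 1 0
      have h00 := star_creation_mul_creation 0 0
      have h11 := star_creation_mul_creation 1 1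
      rw [smul_mul_smul_comm, hrr]
      simp only [add_mul, mul_add, mul_smul_comm, smul_mul_assoc, h00, h01, h10, h11]
      rw [Algebra.algebraMap_eq_smul_one]
      simp only [if_true, zero_ne_one, one_ne_zero, if_false]
      module
    rw [e]
    congr 1
    rcases w s with _ | _ <;> rcases w t with _ | _ <;>
      simp only [StarVar.sign] <;> norm_num
  · intro s x
    simp [add_mul, vacuum_creation_mul]
  · intro s x
    simp [mul_add, vacuum_mul_star_creation]

end Fock

end FreeProb

/-! ### Uniqueness of the circular distribution -/

namespace FreeProb

theorem IsSemicircular.map_aeval_eq {A B : Type*} [Ring A] [StarRing A] [Algebra ℂ A] [Ring B]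
    [StarRing B] [Algebra ℂ B] {φ : A →ₗ[ℂ] ℂ} {ψ : B →ₗ[ℂ] ℂ} {a : A} {b : B}
    (ha : IsSemicircular φ a) (hb : IsSemicircular ψ b) (Q : Polynomial ℂ) :
    φ (Polynomial.aeval a Q) = ψ (Polynomial.aeval b Q) := by
  induction Q using Polynomial.induction_on' with
  | add P Q hP hQ => simp only [map_add, hP, hQ]
  | monomial n z =>
    rw [Polynomial.aeval_monomial, Polynomial.aeval_monomial, ← Algebra.smul_def,
      ← Algebra.smul_def, map_smul, map_smul, ha.moments, hb.moments]

theorem lift_prod_aeval {ι C : Type*} [Ring C] [Algebra ℂ C] (r : ι → C)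
    (u : List (ι × Polynomial ℂ)) :
    FreeAlgebra.lift ℂ r (u.map fun p => Polynomial.aeval (FreeAlgebra.ι ℂ p.1) p.2).prod =
      ((u.map fun p => (p.1, Polynomial.aeval (r p.1) p.2)).map Prod.snd).prod := by
  simp only [map_list_prod, List.map_map]
  congr 2
  funext p
  simp only [Function.comp_apply]
  rw [← Polynomial.aeval_algHom_apply, FreeAlgebra.lift_ι_apply]

/-- The joint distribution of free semi-circular elements is determined. -/
theorem map_lift_eq_of_free {ι : Type*} {A B : Type*} [Ring A] [StarRing A] [Algebra ℂ A] [Ring B]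
    [StarRing B] [Algebra ℂ B] {φ : A →ₗ[ℂ] ℂ} {ψ : B →ₗ[ℂ] ℂ} (hφ : φ 1 = 1) (hψ : ψ 1 = 1)
    {s : ι → A} {t : ι → B} (hs : ∀ i, IsSemicircular φ (s i)) (ht : ∀ i, IsSemicircular ψ (t i))
    (hfs : FreeElements φ s) (hft : FreeElements ψ t) (Q : FreeAlgebra ℂ ι) :
    φ (FreeAlgebra.lift ℂ s Q) = ψ (FreeAlgebra.lift ℂ t Q) := by
  classical
  let word : List (ι × Polynomial ℂ) → FreeAlgebra ℂ ι := fun u =>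
    (u.map fun p => Polynomial.aeval (FreeAlgebra.ι ℂ p.1) p.2).prod
  let good : Set (List (ι × Polynomial ℂ)) := {u | (∀ p ∈ u, φ (Polynomial.aeval (s p.1) p.2) = 0) ∧
    u.IsChain (fun p q => p.1 ≠ q.1)}
  -- `D` is spanned by the alternating words in centred polynomials. It contains `1` and is stable
  -- under left multiplication by generators, hence is everything; freeness then kills every
  -- nonempty word on both sides. Centring with respect to `φ` is enough, since one-variable moments
  -- agree.
  let D : Submodule ℂ (FreeAlgebra ℂ ι) := Submodule.span ℂ (word '' good)
  have hX : ∀ i, φ (Polynomial.aeval (s i) (Polynomial.X : Polynomial ℂ)) = 0 := fun i => by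
    simpa using (hs i).moments 1
  have hmul : ∀ i, ∀ d ∈ D, FreeAlgebra.ι ℂ i * d ∈ D := by
    intro i d hd
    refine Submodule.span_induction ?_ ?_ ?_ ?_ hd
    · rintro _ ⟨u, ⟨hu0, huc⟩, rfl⟩
      by_cases h : ∃ P u', u = (i, P) :: u'
      · obtain ⟨P, u', rfl⟩ := h
        -- A generator meeting its own index is absorbed into the first letter, which is recentred;
        -- the constant `z` leaves the shorter word `u'`.
        set z := φ (Polynomial.aeval (s i) (Polynomial.X * P)) with hz
        have e : FreeAlgebra.ι ℂ i * word ((i, P) :: u') =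
            word ((i, Polynomial.X * P - Polynomial.C z) :: u') + z • word u' := by
          simp only [word, List.map_cons, List.prod_cons, map_sub, map_mul, Polynomial.aeval_X,
            Polynomial.aeval_C, sub_mul, ← Algebra.smul_def, mul_assoc, sub_add_cancel]
        rw [e]
        have hu' : ∀ p ∈ u', φ (Polynomial.aeval (s p.1) p.2) = 0 :=
          fun p hp => hu0 p (List.mem_cons_of_mem _ hp)
        refine Submodule.add_mem _ (Submodule.subset_span ⟨_, ⟨?_, ?_⟩, rfl⟩)
          (Submodule.smul_mem _ _ (Submodule.subset_span ⟨_, ⟨hu', huc.tail⟩, rfl⟩))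
        · intro p hp
          rcases List.mem_cons.1 hp with rfl | hp
          · rw [map_sub, map_sub, ← hz, Polynomial.aeval_C, Algebra.algebraMap_eq_smul_one, map_smul,
              hφ, smul_eq_mul, mul_one, sub_self]
          · exact hu' p hp
        · rw [List.isChain_cons] at huc ⊢
          exact huc
      · have e : FreeAlgebra.ι ℂ i * word u = word ((i, Polynomial.X) :: u) := by
          simp [word]
        rw [e]
        refine Submodule.subset_span ⟨_, ⟨?_, ?_⟩, rfl⟩
        · intro p hp
          rcases List.mem_cons.1 hp with rfl | hp
          · exact hX _
          · exact hu0 p hp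
        · rcases u with _ | ⟨⟨j, P⟩, u⟩
          · simp
          · rw [List.isChain_cons_cons]
            exact ⟨fun (hij : i = j) => h ⟨P, u, by rw [hij]⟩, huc⟩
    · rw [mul_zero]
      exact Submodule.zero_mem _
    · intro x y _ _ hx hy
      rw [mul_add]
      exact Submodule.add_mem _ hx hy
    · intro c x _ hx
      rw [mul_smul_comm]
      exact Submodule.smul_mem _ _ hx
  have hall : ∀ Q : FreeAlgebra ℂ ι, ∀ d ∈ D, Q * d ∈ D := by
    intro Q
    induction Q using FreeAlgebra.induction with
    | grade0 r =>
      intro d hd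
      rw [← Algebra.smul_def]
      exact Submodule.smul_mem _ _ hd
    | grade1 i => exact hmul i
    | mul a b ha hb =>
      intro d hd
      rw [mul_assoc]
      exact ha _ (hb _ hd)
    | add a b ha hb =>
      intro d hd
      rw [add_mul]
      exact Submodule.add_mem _ (ha _ hd) (hb _ hd)
  have hQ : Q ∈ D := by
    have := hall Q 1 (Submodule.subset_span ⟨[], ⟨by simp, by simp⟩, by simp [word]⟩)
    rwa [mul_one] at this
  refine Submodule.span_induction ?_ ?_ ?_ ?_ hQ
  · rintro _ ⟨u, ⟨hu0, huc⟩, rfl⟩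
    rcases eq_or_ne u [] with rfl | hne
    · simp [word, hφ, hψ]
    · rw [lift_prod_aeval s, lift_prod_aeval t, hfs, hft]
      · simpa using hne
      · intro p hp
        obtain ⟨p, _, rfl⟩ := List.mem_map.1 hp
        exact Polynomial.aeval_mem_adjoin_singleton _ _
      · intro p hp
        obtain ⟨p, hpu, rfl⟩ := List.mem_map.1 hp
        rw [← hu0 p hpu]
        exact (IsSemicircular.map_aeval_eq (hs p.1) (ht p.1) p.2).symm
      · rw [List.isChain_map]
        exact huc
      · simpa using hne
      · intro p hp
        obtain ⟨p, _, rfl⟩ := List.mem_map.1 hp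
        exact Polynomial.aeval_mem_adjoin_singleton _ _
      · intro p hp
        obtain ⟨p, hpu, rfl⟩ := List.mem_map.1 hp
        exact hu0 p hpu
      · rw [List.isChain_map]
        exact huc
  · simp
  · intro x y _ _ hx hy
    simp only [map_add, hx, hy]
  · intro c x _ hx
    simp only [map_smul, hx]

/-- A `*`-polynomial in `c` is a polynomial in `s 0` and `s 1` by substitution, since both are
self-adjoint and the star only changes the sign of `i`. -/
theorem starDistribution_circular {A : Type*} [Ring A] [StarRing A] [Algebra ℂ A]
    [StarModule ℂ A] {φ : A →ₗ[ℂ] ℂ} {s : Fin 2 → A} (hs : ∀ i, IsSemicircular φ (s i))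
    (Q : FreeAlgebra ℂ StarVar) :
    starDistribution φ (((Real.sqrt 2 : ℝ) : ℂ)⁻¹ • (s 0 + Complex.I • s 1)) Q =
      φ (FreeAlgebra.lift ℂ s (FreeAlgebra.lift ℂ (fun v : StarVar =>
        ((Real.sqrt 2 : ℝ) : ℂ)⁻¹ • (FreeAlgebra.ι ℂ (0 : Fin 2) +
          ((v.sign : ℂ) * Complex.I) • FreeAlgebra.ι ℂ (1 : Fin 2))) Q)) := by
  have hrs : star (((Real.sqrt 2 : ℝ) : ℂ)⁻¹) = ((Real.sqrt 2 : ℝ) : ℂ)⁻¹ := by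
    rw [← Complex.ofReal_inv]
    exact Complex.conj_ofReal _
  rw [starDistribution, LinearMap.comp_apply, AlgHom.toLinearMap_apply, ← AlgHom.comp_apply]
  congr 2
  refine FreeAlgebra.hom_ext (funext fun v => ?_)
  rcases v with _ | _
  · simp [StarVar.sign]
  · rw [Function.comp_apply, Function.comp_apply, FreeAlgebra.lift_ι_apply, AlgHom.comp_apply,
      FreeAlgebra.lift_ι_apply, star_smul, hrs]
    simp [StarVar.sign, (hs 0).selfAdjoint.star_eq, (hs 1).selfAdjoint.star_eq]

/-- All circular elements have the same `*`-distribution. -/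
theorem IsCircular.starDistribution_eq {A B : Type*} [Ring A] [StarRing A] [Algebra ℂ A]
    [StarModule ℂ A] [Ring B] [StarRing B] [Algebra ℂ B] [StarModule ℂ B] {φ : A →ₗ[ℂ] ℂ}
    {ψ : B →ₗ[ℂ] ℂ} (hφ : φ 1 = 1) (hψ : ψ 1 = 1) {a : A} {b : B} (ha : IsCircular φ a)
    (hb : IsCircular ψ b) : starDistribution φ a = starDistribution ψ b := by
  obtain ⟨s, hs, hfs, rfl⟩ := ha
  obtain ⟨t, ht, hft, rfl⟩ := hb
  refine LinearMap.ext fun Q => ?_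
  rw [starDistribution_circular hs, starDistribution_circular ht]
  exact map_lift_eq_of_free hφ hψ hs ht hfs hft _

theorem starDistribution_prod {A : Type*} [Ring A] [StarRing A] [Algebra ℂ A] (φ : A →ₗ[ℂ] ℂ)
    (a : A) (l : List StarVar) : starDistribution φ a (l.map (FreeAlgebra.ι ℂ)).prod =
      φ (l.map (StarVar.eval a)).prod := by
  rw [starDistribution, LinearMap.comp_apply, AlgHom.toLinearMap_apply, map_list_prod, List.map_map]
  congr 3
  funext v
  rcases v with _ | _ <;> simp [StarVar.eval]

/-- Convergence in `*`-distribution may be tested on words. -/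
theorem convergesInStarDistribution_of_words {B : ℕ → Type*} [∀ n, Ring (B n)]
    [∀ n, StarRing (B n)] [∀ n, Algebra ℂ (B n)] (φB : ∀ n, B n →ₗ[ℂ] ℂ) (b : ∀ n, B n)
    {A : Type*} [Ring A] [StarRing A] [Algebra ℂ A] (φ : A →ₗ[ℂ] ℂ) (a : A)
    (h : ∀ (w : ℕ → StarVar) (m : ℕ),
      Tendsto (fun n => φB n ((List.range m).map fun t => (w t).eval (b n)).prod) atTop
        (𝓝 (φ ((List.range m).map fun t => (w t).eval a).prod))) :
    ConvergesInStarDistribution φB b φ a := by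
  intro Q
  have hw : ∀ l : List StarVar, ∃ w : ℕ → StarVar, l = (List.range l.length).map w := fun l =>
    ⟨fun t => l.getD t StarVar.X, by
      refine List.ext_getElem (by simp) fun i h1 h2 => ?_
      simp [h1]⟩
  let D : Submodule ℂ (FreeAlgebra ℂ StarVar) :=
    Submodule.span ℂ (Set.range fun l : List StarVar => (l.map (FreeAlgebra.ι ℂ)).prod)
  have hall : ∀ Q : FreeAlgebra ℂ StarVar, ∀ d ∈ D, Q * d ∈ D := by
    intro Q
    induction Q using FreeAlgebra.induction with
    | grade0 r =>
      intro d hd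
      rw [← Algebra.smul_def]
      exact Submodule.smul_mem _ _ hd
    | grade1 v =>
      intro d hd
      refine Submodule.span_induction ?_ ?_ ?_ ?_ hd
      · rintro _ ⟨l, rfl⟩
        exact Submodule.subset_span ⟨v :: l, by simp⟩
      · rw [mul_zero]
        exact Submodule.zero_mem _
      · intro x y _ _ hx hy
        rw [mul_add]
        exact Submodule.add_mem _ hx hy
      · intro c x _ hx
        rw [mul_smul_comm]
        exact Submodule.smul_mem _ _ hx
    | mul a b ha hb =>
      intro d hd
      rw [mul_assoc]
      exact ha _ (hb _ hd)
    | add a b ha hb =>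
      intro d hd
      rw [add_mul]
      exact Submodule.add_mem _ (ha _ hd) (hb _ hd)
  have hQ : Q ∈ D := by
    have := hall Q 1 (Submodule.subset_span ⟨[], by simp⟩)
    rwa [mul_one] at this
  refine Submodule.span_induction ?_ ?_ ?_ ?_ hQ
  · rintro _ ⟨l, rfl⟩
    simp only [starDistribution_prod]
    obtain ⟨w, hw⟩ := hw l
    have := h w l.length
    rw [hw]
    simpa [List.map_map, Function.comp_def] using this
  · simp
  · intro x y _ _ hx hy
    simpa only [map_add] using hx.add hy
  · intro c x _ hx
    simpa only [map_smul] using hx.const_smul c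

end FreeProb

/-! ### Counting closed walks by noncrossing pairings -/

namespace FreeProb

/-- Exchanging the coordinate `p t` with `v` is an involution of the pairs `(p, v)`. -/
theorem sum_sum_update {ι V M : Type*} [Fintype ι] [DecidableEq ι] [Fintype V] [AddCommMonoid M]
    (F : (ι → V) → M) (t : ι) :
    ∑ p, ∑ v, F (Function.update p t v) = Fintype.card V • ∑ p, F p := by
  let σ : (ι → V) × V → (ι → V) × V := fun x => (Function.update x.1 t x.2, x.1 t)
  have hσ : Function.Involutive σ := by
    rintro ⟨p, v⟩
    simp [σ]
  rw [← Fintype.sum_prod_type' (f := fun p v => F (Function.update p t v)), Finset.smul_sum]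
  calc ∑ x : (ι → V) × V, F (Function.update x.1 t x.2) = ∑ x : (ι → V) × V, F (σ x).1 := rfl
    _ = ∑ x : (ι → V) × V, F x.1 := Equiv.sum_comp (hσ.toPerm) fun x => F x.1
    _ = _ := by
      rw [Fintype.sum_prod_type]
      simp

/-- If `h` does not depend on the coordinate `t`, then the condition `p t = p s` costs a factor
equal to the number of points. -/
theorem card_mul_sum_ite_eq {ι V : Type*} [Fintype ι] [DecidableEq ι] [Fintype V] [DecidableEq V]
    (h : (ι → V) → ℂ) (s t : ι) (hst : s ≠ t) (hh : ∀ p v, h (Function.update p t v) = h p) :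
    (Fintype.card V : ℂ) * ∑ p, h p * (if p s = p t then 1 else 0) = ∑ p, h p := by
  rw [← nsmul_eq_mul, ← sum_sum_update _ t]
  refine Finset.sum_congr rfl fun p _ => ?_
  simp [hh, Function.update_of_ne hst]

/-- The weight of a pair of steps of a walk: one if the steps carry opposite letters and traverse
the same edge in opposite directions. -/
def stepWeight {V : Type*} [DecidableEq V] (w : ℕ → StarVar) (p : ℕ → V) (s t : ℕ) : ℂ :=
  if (w s).sign + (w t).sign = 0 ∧ p s = p (t + 1) ∧ p (s + 1) = p t then 1 else 0

theorem ncSum_stepWeight_congr {V : Type*} [DecidableEq V] (w : ℕ → StarVar) {p p' : ℕ → V}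
    (a b : ℕ) (h : ∀ t, a ≤ t → t ≤ b → p t = p' t) :
    ncSum (stepWeight w p) a b = ncSum (stepWeight w p') a b := by
  refine ncSum_congr a b fun s t hs hst ht => ?_
  rw [stepWeight, stepWeight, h s hs (by omega), h (t + 1) (by omega) (by omega),
    h (s + 1) (by omega) (by omega), h t (by omega) (by omega)]

/-- The pair containing the first step gives `p a = p (j + 1)`, and the block after `j` continues
the chain of equalities to `b`. -/
theorem eq_of_ncSum_stepWeight_ne_zero {V : Type*} [DecidableEq V] (w : ℕ → StarVar) (p : ℕ → V)
    (a b : ℕ) (hab : a ≤ b) (h : ncSum (stepWeight w p) a b ≠ 0) : p a = p b := by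
  induction hL : b - a using Nat.strong_induction_on generalizing a b with
  | _ L ih =>
    rcases hab.eq_or_lt with rfl | hab
    · rfl
    · rw [ncSum_of_lt _ hab] at h
      obtain ⟨j, hj, hne⟩ := Finset.exists_ne_zero_of_sum_ne_zero h
      rw [Finset.mem_Ico] at hj
      have h1 : stepWeight w p a j ≠ 0 := fun h0 => hne (by simp [h0])
      have h3 : ncSum (stepWeight w p) (j + 1) b ≠ 0 := fun h0 => hne (by simp [h0])
      rw [stepWeight] at h1
      have h2 := (ite_ne_right_iff.1 h1).1
      rw [h2.2.1]
      exact ih (b - (j + 1)) (by omega) (j + 1) b (by omega) h3 rfl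

/-- The sequence of vertices of a walk with `m` steps, indexed by natural numbers. -/
def vertexSeq {V : Type*} {m : ℕ} (p : Fin (m + 1) → V) (t : ℕ) : V := p (Fin.ofNat (m + 1) t)

theorem ofNat_ne_ofNat {m s t : ℕ} (hs : s ≤ m) (ht : t ≤ m) (h : s ≠ t) :
    Fin.ofNat (m + 1) s ≠ Fin.ofNat (m + 1) t := by
  intro h'
  have := congrArg Fin.val h'
  rw [Fin.val_ofNat, Fin.val_ofNat, Nat.mod_eq_of_lt (by omega), Nat.mod_eq_of_lt (by omega)] at this
  exact h this

theorem vertexSeq_update_of_ne {V : Type*} {m : ℕ} (p : Fin (m + 1) → V) (v : V) {s t : ℕ}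
    (hs : s ≤ m) (ht : t ≤ m) (h : s ≠ t) :
    vertexSeq (Function.update p (Fin.ofNat (m + 1) t) v) s = vertexSeq p s :=
  Function.update_of_ne (ofNat_ne_ofNat hs ht h) _ _

/-- The sum over all walks of the number of noncrossing pairings compatible with the walk. -/
theorem sum_mul_ncSum_stepWeight {V : Type*} [Fintype V] [DecidableEq V] (w : ℕ → StarVar) (m : ℕ)
    (r : ℂ) (hr : r * r = Fintype.card V) (a b : ℕ) (hab : a ≤ b) (hb : b ≤ m)
    (h : (Fin (m + 1) → V) → ℂ)
    (hh : ∀ p (t : ℕ) v, a < t → t ≤ b → h (Function.update p (Fin.ofNat (m + 1) t) v) = h p) :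
    r ^ (b - a) * ∑ p : Fin (m + 1) → V, h p * ncSum (stepWeight w (vertexSeq p)) a b =
      ncSum (fun s t => if (w s).sign + (w t).sign = 0 then 1 else 0) a b * ∑ p, h p := by
  induction hL : b - a using Nat.strong_induction_on generalizing a b h with
  | _ L ih =>
    subst hL
    rcases hab.eq_or_lt with rfl | hab
    · simp [ncSum_of_le]
    · rw [ncSum_of_lt _ hab, Finset.sum_mul]
      simp_rw [ncSum_of_lt (stepWeight w _) hab, Finset.mul_sum]
      rw [Finset.sum_comm]
      refine Finset.sum_congr rfl fun j hj => ?_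
      rw [Finset.mem_Ico] at hj
      by_cases hw : (w a).sign + (w j).sign = 0
      · rw [if_pos hw, one_mul]
        -- The pair `(a, j)` asks for `p a = p (j + 1)` and `p (a + 1) = p j`; the second holds
        -- automatically because the inner block closes up. So a pair costs a single factor `r * r`,
        -- the number of points.
        let h1 : (Fin (m + 1) → V) → ℂ := fun p =>
          h p * if vertexSeq p a = vertexSeq p (j + 1) then 1 else 0
        let h2 : (Fin (m + 1) → V) → ℂ := fun p =>
          h1 p * ncSum (stepWeight w (vertexSeq p)) (a + 1) j
        have e : ∀ p : Fin (m + 1) → V, h p * (stepWeight w (vertexSeq p) a j *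
            ncSum (stepWeight w (vertexSeq p)) (a + 1) j *
              ncSum (stepWeight w (vertexSeq p)) (j + 1) b) =
            h2 p * ncSum (stepWeight w (vertexSeq p)) (j + 1) b := by
          intro p
          by_cases h0 : ncSum (stepWeight w (vertexSeq p)) (a + 1) j = 0
          · simp [h0, h2]
          · have h3 := eq_of_ncSum_stepWeight_ne_zero w _ _ _ (by omega) h0
            have h4 : stepWeight w (vertexSeq p) a j =
                if vertexSeq p a = vertexSeq p (j + 1) then 1 else 0 := by
              simp only [stepWeight, hw, h3, true_and, and_true]
            simp only [h2, h1, h4, mul_assoc]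
        -- The constraints are removed from right to left: the outer block, then the inner block,
        -- then the coordinate `j + 1`. At each stage the remaining weight ignores the coordinates
        -- being summed.
        have i1 := ih (b - (j + 1)) (by omega) (j + 1) b (by omega) hb h2 (by
          intro p t v h3 h4
          have hupd : ∀ s : ℕ, s < t → vertexSeq (Function.update p (Fin.ofNat (m + 1) t) v) s =
              vertexSeq p s :=
            fun s hs => vertexSeq_update_of_ne p v (by omega) (by omega) (by omega)
          simp only [h2, h1]
          rw [hh p t v (by omega) h4, hupd a (by omega), hupd (j + 1) (by omega),
            ncSum_stepWeight_congr w (a + 1) j fun s _ hs => hupd s (by omega)]) rfl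
        have i2 := ih (j - (a + 1)) (by omega) (a + 1) j (by omega) (by omega) h1 (by
          intro p t v h3 h4
          simp only [h1]
          rw [hh p t v (by omega) (by omega),
            vertexSeq_update_of_ne p v (s := a) (by omega) (by omega) (by omega),
            vertexSeq_update_of_ne p v (s := j + 1) (by omega) (by omega) (by omega)]) rfl
        have i3 : (Fintype.card V : ℂ) * ∑ p, h1 p = ∑ p, h p :=
          card_mul_sum_ite_eq h (Fin.ofNat (m + 1) a) (Fin.ofNat (m + 1) (j + 1))
            (ofNat_ne_ofNat (by omega) (by omega) (by omega))
            (fun p v => hh p (j + 1) v (by omega) (by omega))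
        rw [← hr] at i3
        rw [← Finset.mul_sum, Finset.sum_congr rfl fun p _ => e p, ← Finset.mul_sum]
        have e2 : ∑ p, h2 p = ∑ p, h1 p * ncSum (stepWeight w (vertexSeq p)) (a + 1) j := rfl
        rw [← e2] at i2
        rw [show b - a = (b - (j + 1)) + ((j - (a + 1)) + 2) by omega, pow_add, pow_add, ← i3]
        linear_combination (r ^ (j - (a + 1)) * r ^ 2) * i1 + (r ^ 2 *
          ncSum (fun s t => if (w s).sign + (w t).sign = 0 then 1 else 0) (j + 1) b) * i2
      · simp [hw, stepWeight]

end FreeProb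

/-! ### Mixed moments of the input variables -/

namespace FreeProb

theorem StarVar.norm_eval (v : StarVar) (z : ℂ) : ‖v.eval z‖ = ‖z‖ := by
  rcases v with _ | _ <;> simp [StarVar.eval]

theorem StarVar.measurable_eval (v : StarVar) : Measurable fun z : ℂ => v.eval z := by
  rcases v with _ | _
  · exact measurable_id
  · exact continuous_star.measurable

theorem StarVar.eval_mul_eval (v v' : StarVar) (h : v.sign + v'.sign = 0) (z : ℂ) :
    v.eval z * v'.eval z = ((‖z‖ ^ 2 : ℝ) : ℂ) := by
  rcases v with _ | _ <;> rcases v' with _ | _ <;> simp only [StarVar.sign] at h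
  · omega
  · simp [StarVar.eval, Complex.mul_conj']
  · simp [StarVar.eval, Complex.conj_mul']
  · omega

end FreeProb

namespace RandomMatrix

open FreeProb

variable {Ω : Type*} [MeasurableSpace Ω] {P : Measure Ω} {x : ℤ → Ω → ℂ}

/-- Factors with the same label are grouped, and variables with distinct labels are independent. -/
theorem IsInput.integral_prod_eval (hx : IsInput P x) (w : ℕ → StarVar) (m : ℕ) (α : ℕ → ℤ) :
    ∫ ω, ∏ t ∈ Finset.range m, (w t).eval (x (α t) ω) ∂P =
      ∏ v ∈ (Finset.range m).image α,
        ∫ ω, ∏ t ∈ Finset.range m with α t = v, (w t).eval (x v ω) ∂P := by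
  classical
  set I := (Finset.range m).image α with hI
  let f : I → ℂ → ℂ := fun v z => ∏ t ∈ Finset.range m with α t = v, (w t).eval z
  have hf : ∀ v, Measurable (f v) := fun v =>
    Finset.measurable_prod _ fun t _ => (w t).measurable_eval
  have h := (hx.indep.precomp (g := fun v : I => (v : ℤ))
    Subtype.val_injective).integral_fun_prod_comp (f := f)
    (fun v => (hx.measurable _).aemeasurable) (fun v => (hf v).aestronglyMeasurable)
  rw [← Finset.prod_coe_sort I]
  rw [← h]
  refine integral_congr_ae (ae_of_all _ fun ω => ?_)
  change ∏ t ∈ Finset.range m, (w t).eval (x (α t) ω) = ∏ v : I, ∏ t ∈ Finset.range m with α t = v, (w t).eval (x v ω)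
  rw [Finset.prod_coe_sort I (fun v => ∏ t ∈ Finset.range m with α t = v, (w t).eval (x v ω)),
    ← Finset.prod_fiberwise_of_maps_to (g := α) (t := I)
      (fun t ht => Finset.mem_image_of_mem _ ht)]
  refine Finset.prod_congr rfl fun v _ => Finset.prod_congr rfl fun t ht => ?_
  rw [(Finset.mem_filter.1 ht).2]

theorem IsInput.integral_eval (hx : IsInput P x) (v : StarVar) (a : ℤ) :
    ∫ ω, v.eval (x a ω) ∂P = 0 := by
  rcases v with _ | _
  · exact hx.mean_zero a
  · change ∫ ω, (starRingEnd ℂ) (x a ω) ∂P = 0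
    rw [integral_conj, hx.mean_zero, map_zero]

/-- A mixed moment in which some variable occurs exactly once vanishes. -/
theorem IsInput.integral_prod_eval_eq_zero (hx : IsInput P x) (w : ℕ → StarVar) (m : ℕ)
    (α : ℕ → ℤ) (t : ℕ) (ht : t < m) (huniq : ∀ t' < m, α t' = α t → t' = t) :
    ∫ ω, ∏ t ∈ Finset.range m, (w t).eval (x (α t) ω) ∂P = 0 := by
  rw [hx.integral_prod_eval]
  refine Finset.prod_eq_zero (Finset.mem_image_of_mem α (Finset.mem_range.2 ht)) ?_
  have : (Finset.range m).filter (fun t' => α t' = α t) = {t} := by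
    ext t'
    simp only [Finset.mem_filter, Finset.mem_range, Finset.mem_singleton]
    exact ⟨fun h => huniq t' h.1 h.2, by rintro rfl; exact ⟨ht, rfl⟩⟩
  simp only [this, Finset.prod_singleton]
  exact hx.integral_eval _ _

/-- A mixed moment in which every variable occurs exactly twice, once conjugated, is one. -/
theorem IsInput.integral_prod_eval_eq_one (hx : IsInput P x) (w : ℕ → StarVar) (m : ℕ)
    (α : ℕ → ℤ) (hpair : ∀ t < m, ∃ t' < m, t' ≠ t ∧ (w t).sign + (w t').sign = 0 ∧
      ∀ u < m, α u = α t ↔ u = t ∨ u = t') :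
    ∫ ω, ∏ t ∈ Finset.range m, (w t).eval (x (α t) ω) ∂P = 1 := by
  rw [hx.integral_prod_eval]
  refine Finset.prod_eq_one fun v hv => ?_
  obtain ⟨t, ht, rfl⟩ := Finset.mem_image.1 hv
  rw [Finset.mem_range] at ht
  obtain ⟨t', ht', hne, hs, hu⟩ := hpair t ht
  have : (Finset.range m).filter (fun u => α u = α t) = {t, t'} := by
    ext u
    simp only [Finset.mem_filter, Finset.mem_range, Finset.mem_singleton, Finset.mem_insert]
    exact ⟨fun h => (hu u h.1).1 h.2, fun h => by
      have hum : u < m := by rcases h with h | h <;> omega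
      exact ⟨hum, (hu u hum).2 h⟩⟩
  simp only [this, Finset.prod_pair hne.symm, StarVar.eval_mul_eval _ _ hs]
  rw [integral_complex_ofReal, hx.unit_variance, Complex.ofReal_one]

theorem IsInput.exists_bound (hx : IsInput P x) (w : ℕ → StarVar) (m : ℕ) :
    ∃ C : ℝ, 0 ≤ C ∧ ∀ α : ℕ → ℤ,
      ‖∫ ω, ∏ t ∈ Finset.range m, (w t).eval (x (α t) ω) ∂P‖ ≤ C := by
  -- By identical distribution each block contributes at most an absolute moment of `x 0` of order
  -- at most `m`, whatever the labels. The summand `1` makes `M ≥ 1`, so that having fewer than `m`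
  -- blocks does no harm.
  set M : ℝ := 1 + ∑ k ∈ Finset.range (m + 1), ∫ ω, ‖x 0 ω‖ ^ k ∂P with hM
  have hnn : ∀ k, 0 ≤ ∫ ω, ‖x 0 ω‖ ^ k ∂P := fun k => integral_nonneg fun ω => by positivity
  have hM1 : 1 ≤ M := le_add_of_nonneg_right (Finset.sum_nonneg fun k _ => hnn k)
  refine ⟨M ^ m, by positivity, fun α => ?_⟩
  rw [hx.integral_prod_eval, norm_prod]
  calc ∏ v ∈ (Finset.range m).image α,
        ‖∫ ω, ∏ t ∈ Finset.range m with α t = v, (w t).eval (x v ω) ∂P‖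
      ≤ ∏ v ∈ (Finset.range m).image α, M := by
        refine Finset.prod_le_prod (fun _ _ => norm_nonneg _) fun v _ => ?_
        refine (norm_integral_le_integral_norm _).trans ?_
        simp only [norm_prod, StarVar.norm_eval, Finset.prod_const]
        set k := ((Finset.range m).filter fun t => α t = v).card with hk
        have hkm : k ≤ m := (Finset.card_filter_le _ _).trans (by simp)
        have h1 : ∫ ω, ‖x v ω‖ ^ k ∂P = ∫ ω, ‖x 0 ω‖ ^ k ∂P :=
          ((hx.identDistrib v 0).comp (u := fun z : ℂ => ‖z‖ ^ k) (by fun_prop)).integral_eq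
        rw [h1, hM]
        refine le_add_of_nonneg_of_le zero_le_one ?_
        exact Finset.single_le_sum (f := fun k => ∫ ω, ‖x 0 ω‖ ^ k ∂P) (fun k _ => hnn k)
          (Finset.mem_range.2 (by omega))
    _ ≤ M ^ m := by
        rw [Finset.prod_const]
        exact pow_le_pow_right₀ hM1 (Finset.card_image_le.trans (by simp))

/-- Mixed moments of the products of two independent families factorize. -/
theorem integral_prod_eval_mul {y : ℤ → Ω → ℂ} (hx : IsInput P x) (hy : IsInput P y)
    (hxy : IndepFun (fun ω α => x α ω) (fun ω α => y α ω) P) (w : ℕ → StarVar) (m : ℕ)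
    (α β : ℕ → ℤ) :
    ∫ ω, ∏ t ∈ Finset.range m, ((w t).eval (x (α t) ω) * (w t).eval (y (β t) ω)) ∂P =
      (∫ ω, ∏ t ∈ Finset.range m, (w t).eval (x (α t) ω) ∂P) *
        ∫ ω, ∏ t ∈ Finset.range m, (w t).eval (y (β t) ω) ∂P := by
  have hm : ∀ γ : ℕ → ℤ, Measurable fun z : ℤ → ℂ => ∏ t ∈ Finset.range m, (w t).eval (z (γ t)) :=
    fun γ => Finset.measurable_prod _ fun t _ => (w t).measurable_eval.comp (measurable_pi_apply _)
  have h := hxy.integral_fun_comp_mul_comp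
    (f := fun z : ℤ → ℂ => ∏ t ∈ Finset.range m, (w t).eval (z (α t)))
    (g := fun z : ℤ → ℂ => ∏ t ∈ Finset.range m, (w t).eval (z (β t)))
    (measurable_pi_lambda _ hx.measurable).aemeasurable
    (measurable_pi_lambda _ hy.measurable).aemeasurable
    (hm α).aestronglyMeasurable (hm β).aestronglyMeasurable
  simp only [Finset.prod_mul_distrib]
  exact h

end RandomMatrix

/-! ### Walks whose labels satisfy a nontrivial linear relation -/

namespace RandomMatrix

open FreeProb

/-- All fibres have at least two points and their sizes add up to `m`; in the extremal case every
fibre has exactly two. -/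
theorem two_mul_card_image_le {m : ℕ} (a : Fin m → ℤ) (ha : ∀ t, ∃ t', t' ≠ t ∧ a t' = a t) :
    2 * (Finset.univ.image a).card ≤ m ∧
      (m ≤ 2 * (Finset.univ.image a).card → ∀ t, ∃ t', t' ≠ t ∧ ∀ u, a u = a t ↔ u = t ∨ u = t') := by
  have hsum : m = ∑ v ∈ Finset.univ.image a, (Finset.univ.filter fun t => a t = v).card := by
    rw [← Finset.card_eq_sum_card_image, Finset.card_univ, Fintype.card_fin]
  have hle : ∀ v ∈ Finset.univ.image a, 2 ≤ (Finset.univ.filter fun t => a t = v).card := by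
    intro v hv
    obtain ⟨t, _, rfl⟩ := Finset.mem_image.1 hv
    obtain ⟨t', hne, ht'⟩ := ha t
    exact Finset.one_lt_card.2 ⟨t, by simp, t', by simp [ht'], hne.symm⟩
  have h2 : ∑ _v ∈ Finset.univ.image a, 2 = 2 * (Finset.univ.image a).card := by
    rw [Finset.sum_const, smul_eq_mul, mul_comm]
  have hle' := Finset.sum_le_sum hle
  refine ⟨by omega, fun hm t => ?_⟩
  have heq := (Finset.sum_eq_sum_iff_of_le hle).1 (by omega) (a t) (by simp)
  obtain ⟨p, q, hpq, hF⟩ := Finset.card_eq_two.1 heq.symm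
  have hmem : ∀ u, a u = a t ↔ u = p ∨ u = q := fun u => by
    have : u ∈ Finset.univ.filter (fun s => a s = a t) ↔ u ∈ ({p, q} : Finset (Fin m)) := by rw [hF]
    simpa using this
  rcases (hmem t).1 rfl with rfl | rfl
  · exact ⟨q, hpq.symm, hmem⟩
  · exact ⟨p, hpq, fun u => (hmem u).trans or_comm⟩

/-- The coefficients, in terms of the increments, of the difference of the `Y`-labels of the steps
`s < t`. -/
def hankelCoeff {m : ℕ} (e : Fin m → ℤ) (s t r : Fin m) : ℤ :=
  e r * ((if s ≤ r ∧ r ≤ t then 1 else 0) + if s < r ∧ r < t then 1 else 0)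

/-- If only trivial relations hold between the labels then both families of labels define the same
noncrossing pairing, which joins opposite signs. -/
theorem exists_noncrossing_partner {m : ℕ} (e a b : Fin m → ℤ) (he : ∀ t, e t = 1 ∨ e t = -1)
    (ha : ∀ t, ∃ t', t' ≠ t ∧ a t' = a t) (hb : ∀ t, ∃ t', t' ≠ t ∧ b t' = b t)
    (hcard : m ≤ 2 * (Finset.univ.image a).card)
    (hclose : ∀ v, ∑ r with a r = a v, e r = 0)
    (hrel : ∀ s t, s < t → b s = b t → ∀ v, ∑ r with a r = a v, hankelCoeff e s t r = 0) (t : Fin m) :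
    ∃ t', t' ≠ t ∧ e t + e t' = 0 ∧ (∀ u, a u = a t ↔ u = t ∨ u = t') ∧
      (∀ u, b u = b t ↔ u = t ∨ u = t') ∧
      ∀ u, t < u → u < t' → ∃ u', t < u' ∧ u' < t' ∧ u' ≠ u ∧ a u' = a u := by
  choose π hπ hmem using (two_mul_card_image_le a ha).2 hcard
  have hfib : ∀ (c : Fin m → ℤ) v, ∑ r with a r = a v, c r = c v + c (π v) := by
    intro c v
    rw [← Finset.sum_pair (hπ v).symm]
    refine Finset.sum_congr ?_ fun _ _ => rfl
    ext u
    simp [hmem v u]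
  have haπ : ∀ v, a (π v) = a v := fun v => (hmem v (π v)).2 (Or.inr rfl)
  -- Up to sign, the coefficients of the relation are `1` at `s` and `t`, `2` strictly between them
  -- and `0` outside. The coefficient at `s` can only be cancelled by that at `t`.
  have hlt : ∀ s t, s < t → b s = b t → π s = t := by
    intro s t hst hbs
    by_contra hne
    have h := hrel s t hst hbs s
    have h1 := hπ s
    rw [hfib, hankelCoeff, hankelCoeff, if_pos ⟨le_rfl, hst.le⟩, if_neg (by simp)] at h
    have h2 := he s
    have h3 := he (π s)
    split_ifs at h with h4 h5 h5
    · omega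
    · exact h5 ⟨lt_of_le_of_ne h4.1 h1.symm, lt_of_le_of_ne h4.2 hne⟩
    · exact h4 ⟨h5.1.le, h5.2.le⟩
    · omega
  have hbpart : ∀ u v, u ≠ v → b u = b v → u = π v := by
    intro u v hne hbu
    rcases lt_or_gt_of_ne hne with h | h
    · have h1 := hlt u v h hbu
      have h2 := haπ u
      rw [h1] at h2
      rcases (hmem v u).1 h2.symm with h3 | h3
      · exact (hne h3).elim
      · exact h3
    · exact (hlt v u h hbu.symm).symm
  have hbπ : ∀ v, b (π v) = b v := by
    intro v
    obtain ⟨u, hu, hbu⟩ := hb v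
    rw [← hbpart u v hu hbu, hbu]
  refine ⟨π t, hπ t, ?_, hmem t, fun u => ⟨fun hu => ?_, ?_⟩, fun u h1 h2 => ?_⟩
  · rw [← hfib]
    exact hclose t
  · by_cases h : u = t
    · exact Or.inl h
    · exact Or.inr (hbpart u t h hu)
  · rintro (rfl | rfl)
    · rfl
    · exact hbπ t
  -- An interior point has coefficient `± 2`, which only another interior point can cancel: the
  -- pairing does not cross.
  · have h := hrel t (π t) (h1.trans h2) (hbπ t).symm u
    rw [hfib, hankelCoeff, hankelCoeff, if_pos ⟨h1.le, h2.le⟩, if_pos ⟨h1, h2⟩] at h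
    have h3 := he u
    have h4 := he (π u)
    refine ⟨π u, ?_, ?_, hπ u, haπ u⟩
    · by_contra h5
      rw [if_neg (c := t < π u ∧ π u < π t) (fun h6 => h5 h6.1)] at h
      split_ifs at h <;> omega
    · by_contra h5
      rw [if_neg (c := t < π u ∧ π u < π t) (fun h6 => h5 h6.2)] at h
      split_ifs at h <;> omega

/-! ### Counting walks through their independent labels -/

section Count

variable {n m : ℕ}

/-- Such a walk is encoded by its starting vertex and its labels on `R`, each of which takes at most
`2 * n + 1` values. -/
theorem card_le_of_determined (a : (Fin (m + 1) → Fin n) → Fin m → ℤ)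
    (habs : ∀ p t, -(n : ℤ) ≤ a p t ∧ a p t ≤ n)
    (hinj : ∀ p p', p 0 = p' 0 → (∀ t, a p t = a p' t) → p = p')
    (T : Finset (Fin (m + 1) → Fin n)) (R : Finset (Fin m))
    (hdet : ∀ p ∈ T, ∀ p' ∈ T, (∀ t ∈ R, a p t = a p' t) → ∀ t, a p t = a p' t) :
    T.card ≤ n * (2 * n + 1) ^ R.card := by
  have hcard : ((Finset.univ : Finset (Fin n)) ×ˢ
      Fintype.piFinset fun _ : R => Finset.Icc (-(n : ℤ)) n).card = n * (2 * n + 1) ^ R.card := by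
    rw [Finset.card_product, Fintype.card_piFinset, Finset.prod_const, Int.card_Icc,
      Finset.card_univ, Finset.card_univ, Fintype.card_fin, Fintype.card_coe]
    congr 2
    omega
  rw [← hcard]
  refine Finset.card_le_card_of_injOn (fun p => (p 0, fun t : R => a p t)) ?_ ?_
  · intro p _
    simp only [Finset.coe_product, Set.mem_prod, Finset.mem_coe, Finset.mem_univ, true_and,
      Fintype.mem_piFinset, Finset.mem_Icc]
    exact fun t => habs p t
  · intro p hp p' hp' h
    obtain ⟨h1, h2⟩ := Prod.mk.inj h
    exact hinj p p' h1 (hdet p hp p' hp' fun t ht => congrFun h2 ⟨t, ht⟩)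

/-- The walks whose labels are constant on the fibres of `g` and, if `k = some (v, i)`, satisfy the
`i`-th linear relation, in which the label of `v` occurs nontrivially. -/
def RelationHolds {K : Type*} (a : Fin m → ℤ) (c : K → Fin m → ℤ) (g : Fin m → Fin m) :
    Option (Fin m × K) → Prop
  | none => 2 * (Finset.univ.image g).card < m ∧ ∀ t, a t = a (g t)
  | some (v, i) => 2 * (Finset.univ.image g).card ≤ m ∧ (∀ t, a t = a (g t)) ∧
      v ∈ Finset.univ.image g ∧ ∑ r with g r = v, c i r ≠ 0 ∧ ∑ r, c i r * a r = 0

/-- Here `g` sends each step to a chosen representative among the steps with the same label. The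
data `(g, k)` range over a set whose size does not depend on `n`. -/
theorem exists_relationHolds {K : Type*} (a : Fin m → ℤ) (c : K → Fin m → ℤ)
    (ha : ∀ t, ∃ t', t' ≠ t ∧ a t' = a t)
    (h : 2 * (Finset.univ.image a).card < m ∨
      ∃ i v, ∑ r with a r = a v, c i r ≠ 0 ∧ ∑ r, c i r * a r = 0) :
    ∃ g k, RelationHolds a c g k := by
  rcases Nat.eq_zero_or_pos m with rfl | hm
  · rcases h with h | ⟨_, v, _⟩
    · omega
    · exact v.elim0
  have : Nonempty (Fin m) := ⟨⟨0, hm⟩⟩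
  let g : Fin m → Fin m := fun t => Function.invFun a (a t)
  have hg : ∀ t, a t = a (g t) := fun t => (Function.invFun_eq ⟨t, rfl⟩).symm
  have hgg : ∀ s t, g s = g t ↔ a s = a t := fun s t =>
    ⟨fun h => by rw [hg s, h, ← hg t], fun h => congrArg (Function.invFun a) h⟩
  have hle : (Finset.univ.image g).card ≤ (Finset.univ.image a).card := by
    have : Finset.univ.image g = (Finset.univ.image a).image (Function.invFun a) := by
      rw [Finset.image_image]
      rfl
    rw [this]
    exact Finset.card_image_le
  have h2 := (two_mul_card_image_le a ha).1
  rcases h with h | ⟨i, v, h1, h0⟩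
  · exact ⟨g, none, by omega, hg⟩
  · refine ⟨g, some (g v, i), by omega, hg, by simp, ?_, h0⟩
    simpa only [hgg] using h1

/-- The labels at the representatives determine all labels. When a relation is available it can be
solved for the label of `v`, so `v` is dropped from `R`; in both cases at most `(m - 1) / 2` labels
remain. -/
theorem determined_of_relationHolds {K : Type*} (c : K → Fin m → ℤ) (g : Fin m → Fin m)
    (k : Option (Fin m × K)) : ∃ R : Finset (Fin m), ∀ a a' : Fin m → ℤ, RelationHolds a c g k →
      RelationHolds a' c g k → R.card ≤ (m - 1) / 2 ∧
        ((∀ t ∈ R, a t = a' t) → ∀ t, a t = a' t) := by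
  rcases k with _ | ⟨v, i⟩
  · refine ⟨Finset.univ.image g, fun a a' h h' => ⟨?_, fun hR t => ?_⟩⟩
    · have := h.1
      omega
    · rw [h.2, h'.2, hR _ (by simp)]
  · refine ⟨(Finset.univ.image g).erase v, fun a a' h h' => ?_⟩
    obtain ⟨h1, h2, h3, h4, h5⟩ := h
    obtain ⟨-, h2', -, -, h5'⟩ := h'
    refine ⟨?_, fun hR => ?_⟩
    · rw [Finset.card_erase_of_mem h3]
      omega
    · have hv : a v = a' v := by
        have e1 : ∑ r, c i r * (a r - a' r) = 0 := by
          simp only [mul_sub, Finset.sum_sub_distrib, h5, h5', sub_self]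
        have e2 : ∑ r, c i r * (a r - a' r) = (∑ r with g r = v, c i r) * (a v - a' v) := by
          rw [Finset.sum_mul, Finset.sum_filter]
          refine Finset.sum_congr rfl fun r _ => ?_
          split_ifs with hr
          · rw [h2 r, h2' r, hr]
          · rw [h2 r, h2' r, hR (g r) (Finset.mem_erase.2 ⟨hr, by simp⟩), sub_self, mul_zero]
        rw [e1] at e2
        rcases mul_eq_zero.1 e2.symm with h | h
        · exact (h4 h).elim
        · exact sub_eq_zero.1 h
      intro t
      rw [h2 t, h2' t]
      by_cases hr : g t = v
      · rw [hr, hv]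
      · exact hR (g t) (Finset.mem_erase.2 ⟨hr, by simp⟩)

theorem card_le_of_relationHolds {K : Type*} [Fintype K] (a : (Fin (m + 1) → Fin n) → Fin m → ℤ)
    (habs : ∀ p t, -(n : ℤ) ≤ a p t ∧ a p t ≤ n)
    (hinj : ∀ p p', p 0 = p' 0 → (∀ t, a p t = a p' t) → p = p') (c : K → Fin m → ℤ)
    (T : Finset (Fin (m + 1) → Fin n)) (hT : ∀ p ∈ T, ∃ g k, RelationHolds (a p) c g k) :
    T.card ≤ Fintype.card ((Fin m → Fin m) × Option (Fin m × K)) *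
      (n * (2 * n + 1) ^ ((m - 1) / 2)) := by
  classical
  have hsub : T ⊆ Finset.univ.biUnion fun d : (Fin m → Fin m) × Option (Fin m × K) =>
      T.filter fun p => RelationHolds (a p) c d.1 d.2 := by
    intro p hp
    obtain ⟨g, k, h⟩ := hT p hp
    exact Finset.mem_biUnion.2 ⟨(g, k), Finset.mem_univ _, Finset.mem_filter.2 ⟨hp, h⟩⟩
  refine (Finset.card_le_card hsub).trans (Finset.card_biUnion_le_card_mul _ _ _ fun d _ => ?_)
  obtain ⟨R, hR⟩ := determined_of_relationHolds c d.1 d.2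
  rcases (T.filter fun p => RelationHolds (a p) c d.1 d.2).eq_empty_or_nonempty with h0 | ⟨p, hp⟩
  · simp [h0]
  · have hRc := (hR _ _ (Finset.mem_filter.1 hp).2 (Finset.mem_filter.1 hp).2).1
    refine (card_le_of_determined a habs hinj _ R fun p hp p' hp' =>
      (hR _ _ (Finset.mem_filter.1 hp).2 (Finset.mem_filter.1 hp').2).2).trans ?_
    gcongr
    omega

end Count

end RandomMatrix

/-! ### The contribution of a closed walk -/

namespace FreeProb

theorem StarVar.sign_eq (v : StarVar) : v.sign = 1 ∨ v.sign = -1 := by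
  rcases v with _ | _ <;> simp [StarVar.sign]

/-- Opposite letters traversing the same edge in opposite directions. -/
def OppositeSteps {V : Type*} (w : ℕ → StarVar) (p : ℕ → V) (s t : ℕ) : Prop :=
  (w s).sign + (w t).sign = 0 ∧ p s = p (t + 1) ∧ p (s + 1) = p t

theorem OppositeSteps.symm {V : Type*} {w : ℕ → StarVar} {p : ℕ → V} {s t : ℕ}
    (h : OppositeSteps w p s t) : OppositeSteps w p t s :=
  ⟨by rw [add_comm]; exact h.1, h.2.2.symm, h.2.1.symm⟩

end FreeProb

namespace RandomMatrix

open FreeProb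

/-- The number, counted from `1`, of the vertex of a walk at a given time. -/
def position {n m : ℕ} (p : Fin (m + 1) → Fin n) (t : ℕ) : ℤ := ((vertexSeq p t : Fin n) : ℕ) + 1

/-- The index of the Toeplitz input variable at a step of a walk. -/
def toeplitzLabel {n m : ℕ} (w : ℕ → StarVar) (p : Fin (m + 1) → Fin n) (t : ℕ) : ℤ :=
  (w t).sign * (position p t - position p (t + 1))

/-- The index of the Hankel input variable at a step of a walk. -/
def hankelLabel {n m : ℕ} (p : Fin (m + 1) → Fin n) (t : ℕ) : ℤ :=
  position p t + position p (t + 1)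

theorem sum_Ico_sub_succ (D : ℕ → ℤ) {a b : ℕ} (h : a ≤ b) :
    ∑ r ∈ Finset.Ico a b, (D r - D (r + 1)) = D a - D b := by
  induction b, h using Nat.le_induction with
  | base => simp
  | succ b h ih => rw [Finset.sum_Ico_succ_top h, ih]; ring

section Walk

variable {n m : ℕ} (w : ℕ → StarVar) (p : Fin (m + 1) → Fin n)

theorem sign_mul_toeplitzLabel (t : ℕ) :
    (w t).sign * toeplitzLabel w p t = position p t - position p (t + 1) := by
  rw [toeplitzLabel, ← mul_assoc]
  rcases (w t).sign_eq with h | h <;> simp [h]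

theorem position_inj {s t : ℕ} (h : position p s = position p t) : vertexSeq p s = vertexSeq p t := by
  rw [position, position] at h
  exact Fin.ext (by omega)

theorem abs_toeplitzLabel (t : ℕ) : -(n : ℤ) ≤ toeplitzLabel w p t ∧ toeplitzLabel w p t ≤ n := by
  have h1 := (vertexSeq p t).2
  have h2 := (vertexSeq p (t + 1)).2
  rw [toeplitzLabel, position, position]
  rcases (w t).sign_eq with h | h <;> rw [h] <;> constructor <;> omega

theorem eq_of_toeplitzLabel_eq (p p' : Fin (m + 1) → Fin n) (h0 : p 0 = p' 0)
    (h : ∀ t : Fin m, toeplitzLabel w p t = toeplitzLabel w p' t) : p = p' := by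
  have key : ∀ t ≤ m, position p t = position p' t := by
    intro t
    induction t with
    | zero =>
      intro _
      have : vertexSeq p 0 = vertexSeq p' 0 := h0
      rw [position, position, this]
    | succ t ih =>
      intro ht
      have h1 := ih (by omega)
      have h2 := h ⟨t, ht⟩
      have h3 := sign_mul_toeplitzLabel w p t
      have h4 := sign_mul_toeplitzLabel w p' t
      simp only at h2
      rw [h2, h4, h1] at h3
      omega
  funext t
  have h1 := key t (by omega)
  have e : ∀ q : Fin (m + 1) → Fin n, vertexSeq q t = q t := fun q => by simp [vertexSeq]
  rw [position, position, e, e] at h1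
  exact Fin.ext (by omega)

theorem sum_sign_mul_toeplitzLabel (hp : vertexSeq p m = vertexSeq p 0) :
    ∑ r : Fin m, (w r).sign * toeplitzLabel w p r = 0 := by
  rw [Fin.sum_univ_eq_sum_range (fun r => (w r).sign * toeplitzLabel w p r)]
  simp only [sign_mul_toeplitzLabel]
  rw [Finset.sum_range_sub', position, position, hp, sub_self]

/-- The increments telescope to `p s - p (t + 1)` over `[s, t]` and to `p (s + 1) - p t` over the
open interval; the total is the difference of the Hankel labels. -/
theorem sum_hankelCoeff_mul_toeplitzLabel (s t : Fin m) (hst : s < t)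
    (h : hankelLabel p s = hankelLabel p t) :
    ∑ r : Fin m, hankelCoeff (fun r : Fin m => (w r).sign) s t r * toeplitzLabel w p r = 0 := by
  have hst' : (s : ℕ) < t := hst
  have e : ∀ r : Fin m, hankelCoeff (fun r : Fin m => (w r).sign) s t r * toeplitzLabel w p r =
      (if (s : ℕ) ≤ r ∧ (r : ℕ) < t + 1 then position p r - position p (r + 1) else 0) +
        if (s : ℕ) + 1 ≤ r ∧ (r : ℕ) < t then position p r - position p (r + 1) else 0 := by
    intro r
    rw [← sign_mul_toeplitzLabel w p r, hankelCoeff]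
    simp only [Fin.le_def, Fin.lt_def, Nat.lt_succ_iff, Nat.succ_le_iff]
    split_ifs <;> ring
  rw [Finset.sum_congr rfl fun r _ => e r, Fin.sum_univ_eq_sum_range (fun r =>
      (if (s : ℕ) ≤ r ∧ (r : ℕ) < t + 1 then position p r - position p (r + 1) else 0) +
        if (s : ℕ) + 1 ≤ r ∧ (r : ℕ) < t then position p r - position p (r + 1) else 0),
    Finset.sum_add_distrib, ← Finset.sum_filter, ← Finset.sum_filter]
  have f : ∀ a b : ℕ, b ≤ m → (Finset.range m).filter (fun r => a ≤ r ∧ r < b) = Finset.Ico a b := by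
    intro a b hb
    ext r
    simp only [Finset.mem_filter, Finset.mem_range, Finset.mem_Ico]
    omega
  rw [f _ _ (by omega), f _ _ (by omega), sum_Ico_sub_succ _ (by omega),
    sum_Ico_sub_succ _ (by omega)]
  rw [hankelLabel, hankelLabel] at h
  linarith

theorem labels_eq_of_oppositeSteps {s t : ℕ} (h : OppositeSteps w (vertexSeq p) s t) :
    toeplitzLabel w p s = toeplitzLabel w p t ∧ hankelLabel p s = hankelLabel p t := by
  obtain ⟨h1, h2, h3⟩ := h
  have e : (w s).sign = -(w t).sign := by omega
  simp only [toeplitzLabel, hankelLabel, position, h2, h3, e]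
  constructor <;> ring

/-- For opposite letters, equal labels fix both the sum of the end points and their difference up to
the reversal, hence the end points themselves. -/
theorem oppositeSteps_of_labels_eq {s t : ℕ} (h0 : (w s).sign + (w t).sign = 0)
    (h1 : toeplitzLabel w p s = toeplitzLabel w p t) (h2 : hankelLabel p s = hankelLabel p t) :
    OppositeSteps w (vertexSeq p) s t := by
  have e : (w s).sign = -(w t).sign := by omega
  rw [toeplitzLabel, toeplitzLabel, e] at h1
  rw [hankelLabel, hankelLabel] at h2
  refine ⟨h0, position_inj p ?_, position_inj p ?_⟩ <;>
    rcases (w t).sign_eq with h | h <;> rw [h] at h1 <;> omega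

variable {Ω : Type*} [MeasurableSpace Ω] (P : Measure Ω) (x y : ℤ → Ω → ℂ)

/-- The expectation of the product of the input variables along a walk. -/
def walkMoment : ℂ :=
  ∫ ω, ∏ t ∈ Finset.range m, ((w t).eval (x (toeplitzLabel w p t) ω) *
    (w t).eval (y (hankelLabel p t) ω)) ∂P

/-- The linear relations between increments that come from closing the walk and from coincidences
of Hankel labels. -/
def walkRelation (w : ℕ → StarVar) : Option (Fin m × Fin m) → Fin m → ℤ
  | none => fun r => (w r).sign
  | some st => hankelCoeff (fun r => (w r).sign) st.1 st.2

variable {P x y}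

theorem ncSum_eq_zero_of_forall_not {t : ℕ} (ht : t < m)
    (h : ∀ t' < m, OppositeSteps w (vertexSeq p) t t' → t' = t) :
    ncSum (stepWeight w (vertexSeq p)) 0 m = 0 := by
  by_contra h0
  obtain ⟨t', -, h1, h2, h3⟩ := exists_partner_of_ncSum_ne_zero _ (OppositeSteps w (vertexSeq p))
    (fun _ _ => OppositeSteps.symm) (fun s t hst => by
      by_contra hn
      exact hst (if_neg hn)) 0 m h0 t (Nat.zero_le _) ht
  exact h2 (h t' h1 h3)

/-- If a label of either kind is unrepeated, both sides vanish. Otherwise either a label is lost or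
a nontrivial relation holds, or else the labels define a single noncrossing pairing and both sides
are `1`. -/
theorem walkMoment_eq_ncSum_or (hx : IsInput P x) (hy : IsInput P y)
    (hxy : IndepFun (fun ω α => x α ω) (fun ω α => y α ω) P)
    (hp : vertexSeq p m = vertexSeq p 0) :
    walkMoment w p P x y = ncSum (stepWeight w (vertexSeq p)) 0 m ∨
      ∃ g k, RelationHolds (fun t : Fin m => toeplitzLabel w p t) (walkRelation w) g k := by
  have hmom : walkMoment w p P x y =
      (∫ ω, ∏ t ∈ Finset.range m, (w t).eval (x (toeplitzLabel w p t) ω) ∂P) *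
        ∫ ω, ∏ t ∈ Finset.range m, (w t).eval (y (hankelLabel p t) ω) ∂P :=
    integral_prod_eval_mul hx hy hxy w m _ _
  by_cases ha : ∀ t : Fin m, ∃ t' : Fin m, t' ≠ t ∧ toeplitzLabel w p t' = toeplitzLabel w p t
  swap
  · left
    push Not at ha
    obtain ⟨t, ht⟩ := ha
    have hu : ∀ t' < m, toeplitzLabel w p t' = toeplitzLabel w p t → t' = t := by
      intro t' h1 h2
      by_contra hne
      exact ht ⟨t', h1⟩ (fun h => hne (congrArg Fin.val h)) h2
    rw [hmom, hx.integral_prod_eval_eq_zero w m _ t t.2 hu, zero_mul,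
      ncSum_eq_zero_of_forall_not w p t.2 fun t' h1 h2 =>
        hu t' h1 (labels_eq_of_oppositeSteps w p h2).1.symm]
  by_cases hb : ∀ t : Fin m, ∃ t' : Fin m, t' ≠ t ∧ hankelLabel p t' = hankelLabel p t
  swap
  · left
    push Not at hb
    obtain ⟨t, ht⟩ := hb
    have hu : ∀ t' < m, hankelLabel p t' = hankelLabel p t → t' = t := by
      intro t' h1 h2
      by_contra hne
      exact ht ⟨t', h1⟩ (fun h => hne (congrArg Fin.val h)) h2
    rw [hmom, hy.integral_prod_eval_eq_zero w m _ t t.2 hu, mul_zero,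
      ncSum_eq_zero_of_forall_not w p t.2 fun t' h1 h2 =>
        hu t' h1 (labels_eq_of_oppositeSteps w p h2).2.symm]
  by_cases hr : 2 * (Finset.univ.image fun t : Fin m => toeplitzLabel w p t).card < m ∨
      ∃ i v, ∑ r with toeplitzLabel w p (r : Fin m) = toeplitzLabel w p (v : Fin m),
        walkRelation w i r ≠ 0 ∧ ∑ r : Fin m, walkRelation w i r * toeplitzLabel w p r = 0
  · exact Or.inr (exists_relationHolds _ _ ha hr)
  left
  push Not at hr
  obtain ⟨hcard, hrel⟩ := hr
  have key := exists_noncrossing_partner (fun t : Fin m => (w t).sign)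
    (fun t : Fin m => toeplitzLabel w p t) (fun t : Fin m => hankelLabel p t)
    (fun t => (w t).sign_eq) ha hb hcard
    (fun v => by
      by_contra h
      exact hrel none v h (sum_sign_mul_toeplitzLabel w p hp))
    (fun s t hst hbst v => by
      by_contra h
      exact hrel (some (s, t)) v h (sum_hankelCoeff_mul_toeplitzLabel w p s t hst hbst))
  have key' : ∀ t < m, ∃ t' < m, t' ≠ t ∧ (w t).sign + (w t').sign = 0 ∧
      (∀ u < m, toeplitzLabel w p u = toeplitzLabel w p t ↔ u = t ∨ u = t') ∧
      (∀ u < m, hankelLabel p u = hankelLabel p t ↔ u = t ∨ u = t') ∧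
      ∀ u, t < u → u < t' → ∃ u', t < u' ∧ u' < t' ∧ u' ≠ u ∧
        toeplitzLabel w p u' = toeplitzLabel w p u := by
    intro t ht
    obtain ⟨t', h1, h2, h3, h4, h5⟩ := key ⟨t, ht⟩
    refine ⟨t', t'.2, fun h => h1 (Fin.ext h), h2, fun u hu => ?_, fun u hu => ?_,
      fun u hu hu' => ?_⟩
    · simpa [Fin.ext_iff] using h3 ⟨u, hu⟩
    · simpa [Fin.ext_iff] using h4 ⟨u, hu⟩
    · obtain ⟨u', h6, h7, h8, h9⟩ := h5 ⟨u, hu'.trans t'.2⟩ hu hu'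
      exact ⟨u', h6, h7, fun h => h8 (Fin.ext h), h9⟩
  clear key
  rw [hmom, hx.integral_prod_eval_eq_one w m _ fun t ht => ?_,
    hy.integral_prod_eval_eq_one w m _ fun t ht => ?_, one_mul]
  · choose! π hπm hπ hs hπa hπb hnc using key'
    -- An opposite step has the same Toeplitz label, so it is `s` or `π s`, and the sign condition
    -- rules out `s`.
    have hopp : ∀ s t, s < m → t < m → (OppositeSteps w (vertexSeq p) s t ↔ t = π s) := by
      intro s t hsm htm
      constructor
      · intro h
        rcases (hπa s hsm t htm).1 (labels_eq_of_oppositeSteps w p h).1.symm with h1 | h1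
        · have h2 := h.1
          rw [h1] at h2
          rcases (w s).sign_eq with h3 | h3 <;> omega
        · exact h1
      · rintro rfl
        exact oppositeSteps_of_labels_eq w p (hs s hsm)
          ((hπa s hsm _ htm).2 (Or.inr rfl)).symm ((hπb s hsm _ htm).2 (Or.inr rfl)).symm
    refine (ncSum_eq_one _ (OppositeSteps w (vertexSeq p)) (fun _ _ => OppositeSteps.symm) m
      (fun s t _ _ h => if_pos h) (fun s t _ _ h => if_neg h) ?_ ?_ ?_ 0 m le_rfl ?_).symm
    · intro s t t' h1 h2 h3 h4 h5
      rw [(hopp s t h1 h2).1 h4, (hopp s t' h1 h3).1 h5]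
    · intro s hsm h
      exact hπ s hsm ((hopp s s hsm hsm).1 h).symm
    · intro s t u h1 h2 h3 h4
      have h5 := (hopp s t (by omega) h3).1 h4
      obtain ⟨v, h6, h7, h8, h9⟩ := hnc s (by omega) u h1 (h5 ▸ h2)
      refine ⟨v, h6, by omega, (hopp u v (by omega) (by omega)).2 ?_⟩
      exact ((hπa u (by omega) v (by omega)).1 h9).resolve_left h8
    · intro s _ hsm
      exact ⟨π s, Nat.zero_le _, hπm s hsm, (hopp s _ hsm (hπm s hsm)).2 rfl⟩
  · obtain ⟨t', h1, h2, h3, -, h4, -⟩ := key' t ht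
    exact ⟨t', h1, h2, h3, h4⟩
  · obtain ⟨t', h1, h2, h3, h4, -, -⟩ := key' t ht
    exact ⟨t', h1, h2, h3, h4⟩

end Walk

end RandomMatrix

/-! ### The trace as a sum over closed walks -/

namespace RandomMatrix

open FreeProb

theorem vertexSeq_snoc {V : Type*} {m : ℕ} (p : Fin (m + 1) → V) (v : V) {t : ℕ} (ht : t ≤ m) :
    vertexSeq (Fin.snoc (α := fun _ => V) p v : Fin (m + 2) → V) t = vertexSeq p t := by
  have e : Fin.ofNat (m + 2) t = (Fin.ofNat (m + 1) t).castSucc := by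
    ext
    simp [Nat.mod_eq_of_lt (by omega : t < m + 1), Nat.mod_eq_of_lt (by omega : t < m + 2)]
  rw [vertexSeq, vertexSeq, e, Fin.snoc_castSucc]

theorem vertexSeq_snoc_last {V : Type*} {m : ℕ} (p : Fin (m + 1) → V) (v : V) :
    vertexSeq (Fin.snoc (α := fun _ => V) p v : Fin (m + 2) → V) (m + 1) = v := by
  have e : Fin.ofNat (m + 2) (m + 1) = Fin.last (m + 1) := by
    ext
    simp
  rw [vertexSeq, e, Fin.snoc_last]

theorem prod_apply_eq_sum_walks {R V : Type*} [CommRing R] [Fintype V] [DecidableEq V]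
    (M : ℕ → Matrix V V R) (m : ℕ) (i j : V) :
    ((List.range m).map M).prod i j = ∑ p : Fin (m + 1) → V,
      if vertexSeq p 0 = i ∧ vertexSeq p m = j then
        ∏ t ∈ Finset.range m, M t (vertexSeq p t) (vertexSeq p (t + 1)) else 0 := by
  induction m generalizing j with
  | zero =>
    rw [← (Equiv.funUnique (Fin 1) V).symm.sum_comp]
    simp only [List.range_zero, List.map_nil, List.prod_nil, Finset.range_zero, Finset.prod_empty]
    change _ = ∑ v : V, if v = i ∧ v = j then (1 : R) else 0
    simp [Matrix.one_apply, ite_and]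
  | succ m ih =>
    rw [List.range_succ, List.map_append, List.prod_append, Matrix.mul_apply]
    rw [← (Fin.snocEquiv fun _ : Fin (m + 2) => V).sum_comp, Fintype.sum_prod_type_right]
    simp only [ih, Finset.sum_mul]
    rw [Finset.sum_comm]
    refine Finset.sum_congr rfl fun p _ => ?_
    have e : ∀ v, (Fin.snocEquiv fun _ : Fin (m + 2) => V) (v, p) =
        (Fin.snoc (α := fun _ => V) p v : Fin (m + 2) → V) := fun v => rfl
    simp only [e, vertexSeq_snoc_last, Finset.prod_range_succ, vertexSeq_snoc p _ (Nat.zero_le m),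
      vertexSeq_snoc p _ le_rfl]
    have f : ∀ v, ∏ t ∈ Finset.range m, M t
        (vertexSeq (Fin.snoc (α := fun _ => V) p v : Fin (m + 2) → V) t)
        (vertexSeq (Fin.snoc (α := fun _ => V) p v : Fin (m + 2) → V) (t + 1)) =
        ∏ t ∈ Finset.range m, M t (vertexSeq p t) (vertexSeq p (t + 1)) := by
      intro v
      refine Finset.prod_congr rfl fun t ht => ?_
      rw [Finset.mem_range] at ht
      rw [vertexSeq_snoc p v (by omega), vertexSeq_snoc p v (by omega)]
    simp only [f]
    by_cases h : vertexSeq p 0 = i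
    · simp [h]
    · simp [h]

theorem trace_prod_eq_sum_walks {R V : Type*} [CommRing R] [Fintype V] [DecidableEq V]
    (M : ℕ → Matrix V V R) (m : ℕ) :
    ((List.range m).map M).prod.trace = ∑ p : Fin (m + 1) → V,
      if vertexSeq p m = vertexSeq p 0 then
        ∏ t ∈ Finset.range m, M t (vertexSeq p t) (vertexSeq p (t + 1)) else 0 := by
  simp only [Matrix.trace, Matrix.diag_apply, prod_apply_eq_sum_walks]
  rw [Finset.sum_comm]
  refine Finset.sum_congr rfl fun p _ => ?_
  simp [ite_and]

variable {Ω : Type*} [MeasurableSpace Ω] {P : Measure Ω} [IsProbabilityMeasure P]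

theorem LInfMinus.coeFn_prod (s : Finset ℕ) (f : ℕ → LInfMinus P) :
    (((∏ t ∈ s, f t : LInfMinus P) : Ω →ₘ[P] ℂ) : Ω → ℂ) =ᵐ[P]
      fun ω => ∏ t ∈ s, ((f t : Ω →ₘ[P] ℂ) : Ω → ℂ) ω := by
  induction s using Finset.induction_on with
  | empty =>
    simp only [Finset.prod_empty]
    exact AEEqFun.coeFn_one
  | insert a s ha ih =>
    simp only [Finset.prod_insert ha]
    filter_upwards [ih, AEEqFun.coeFn_mul (f a : Ω →ₘ[P] ℂ) ((∏ t ∈ s, f t : LInfMinus P))]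
      with ω h1 h2
    rw [← h1]
    exact h2

theorem coeFn_scaledProduct {x y : ℤ → Ω → ℂ} (hx : IsInput P x) (hy : IsInput P y) (n : ℕ)
    (i j : Fin n) :
    (((scaledProduct P x y hx hy n i j : LInfMinus P) : Ω →ₘ[P] ℂ) : Ω → ℂ) =ᵐ[P] fun ω =>
      ((Real.sqrt n : ℝ) : ℂ)⁻¹ * (x (toeplitzLink (i + 1) (j + 1)) ω *
        y (hankelLink (i + 1) (j + 1)) ω) := by
  let X := toLInfMinus P (x (toeplitzLink (i + 1) (j + 1))) (hx.memLp _)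
  let Y := toLInfMinus P (y (hankelLink (i + 1) (j + 1))) (hy.memLp _)
  change ((((((Real.sqrt n : ℝ) : ℂ)⁻¹ • (X.1 * Y.1)) : Ω →ₘ[P] ℂ)) : Ω → ℂ) =ᵐ[P] _
  filter_upwards [AEEqFun.coeFn_smul (((Real.sqrt n : ℝ) : ℂ)⁻¹) (X.1 * Y.1),
    AEEqFun.coeFn_mul X.1 Y.1, AEEqFun.coeFn_mk (x (toeplitzLink (i + 1) (j + 1)))
      (hx.memLp (toeplitzLink (i + 1) (j + 1)) 1 le_rfl ENNReal.one_ne_top).aestronglyMeasurable,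
    AEEqFun.coeFn_mk (y (hankelLink (i + 1) (j + 1)))
      (hy.memLp (hankelLink (i + 1) (j + 1)) 1 le_rfl ENNReal.one_ne_top).aestronglyMeasurable]
    with ω h1 h2 h3 h4
  rw [h1, Pi.smul_apply, h2, Pi.mul_apply, smul_eq_mul]
  congr 2

/-- The adjoint exchanges row and column, which negates the Toeplitz index and preserves the Hankel
one; hence the sign in `toeplitzLabel` only. -/
theorem coeFn_eval_scaledProduct {x y : ℤ → Ω → ℂ} (hx : IsInput P x) (hy : IsInput P y) {n m : ℕ}
    (w : ℕ → StarVar) (p : Fin (m + 1) → Fin n) (t : ℕ) :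
    ((((w t).eval (scaledProduct P x y hx hy n) (vertexSeq p t) (vertexSeq p (t + 1)) :
      LInfMinus P) : Ω →ₘ[P] ℂ) : Ω → ℂ) =ᵐ[P] fun ω => ((Real.sqrt n : ℝ) : ℂ)⁻¹ *
        ((w t).eval (x (toeplitzLabel w p t) ω) * (w t).eval (y (hankelLabel p t) ω)) := by
  rw [toeplitzLabel]
  rcases w t with _ | _
  · filter_upwards [coeFn_scaledProduct hx hy n (vertexSeq p t) (vertexSeq p (t + 1))] with ω h
    simp only [StarVar.eval, StarVar.sign, one_mul]
    rw [h]
    simp only [toeplitzLink, hankelLink, hankelLabel, position]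
    push_cast
    rfl
  · filter_upwards [coeFn_scaledProduct hx hy n (vertexSeq p (t + 1)) (vertexSeq p t),
      AEEqFun.coeFn_star (scaledProduct P x y hx hy n (vertexSeq p (t + 1)) (vertexSeq p t)).1]
      with ω h1 h2
    have e1 : toeplitzLink ((vertexSeq p (t + 1) : Fin n) + 1) ((vertexSeq p t : Fin n) + 1) =
        -1 * (position p t - position p (t + 1)) := by
      simp only [toeplitzLink, position]
      push_cast
      ring
    have e2 : hankelLink ((vertexSeq p (t + 1) : Fin n) + 1) ((vertexSeq p t : Fin n) + 1) =
        hankelLabel p t := by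
      simp only [hankelLink, hankelLabel, position]
      push_cast
      ring
    rw [e1, e2] at h1
    simp only [StarVar.eval, StarVar.sign]
    refine h2.trans ?_
    rw [Pi.star_apply, h1, star_mul', star_mul', ← Complex.ofReal_inv]
    congr 1
    exact Complex.conj_ofReal _

theorem normalizedTrace_prod_scaledProduct {x y : ℤ → Ω → ℂ} (hx : IsInput P x) (hy : IsInput P y)
    (n m : ℕ) (w : ℕ → StarVar) :
    normalizedTrace P n ((List.range m).map fun t => (w t).eval (scaledProduct P x y hx hy n)).prod =
      (n : ℂ)⁻¹ * ((((Real.sqrt n : ℝ) : ℂ)⁻¹) ^ m * ∑ p : Fin (m + 1) → Fin n,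
        if vertexSeq p m = vertexSeq p 0 then walkMoment w p P x y else 0) := by
  rw [normalizedTrace, LinearMap.smul_apply, LinearMap.comp_apply, Matrix.traceLinearMap_apply,
    smul_eq_mul]
  congr 1
  have h := trace_prod_eq_sum_walks (fun t => (w t).eval (scaledProduct P x y hx hy n)) m
  refine (congrArg (expectation P) h).trans ?_
  rw [map_sum, Finset.mul_sum]
  refine Finset.sum_congr rfl fun p _ => ?_
  split_ifs with hp
  · rw [walkMoment, ← integral_const_mul]
    refine integral_congr_ae ?_
    have hall : ∀ᵐ ω ∂P, ∀ t : ℕ, ((((w t).eval (scaledProduct P x y hx hy n) (vertexSeq p t)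
        (vertexSeq p (t + 1)) : LInfMinus P) : Ω →ₘ[P] ℂ) : Ω → ℂ) ω = ((Real.sqrt n : ℝ) : ℂ)⁻¹ *
        ((w t).eval (x (toeplitzLabel w p t) ω) * (w t).eval (y (hankelLabel p t) ω)) :=
      ae_all_iff.2 fun t => coeFn_eval_scaledProduct hx hy w p t
    filter_upwards [hall, LInfMinus.coeFn_prod (P := P) (Finset.range m) fun t =>
      (w t).eval (scaledProduct P x y hx hy n) (vertexSeq p t) (vertexSeq p (t + 1))] with ω h1 h2
    refine h2.trans ?_
    simp only [h1, Finset.prod_mul_distrib, Finset.prod_const, Finset.card_range]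
  · rw [map_zero, mul_zero]

end RandomMatrix

/-! ### Convergence -/

namespace RandomMatrix

open FreeProb

variable {Ω : Type*} [MeasurableSpace Ω] {P : Measure Ω} {x y : ℤ → Ω → ℂ}

/-- The summands agree off the set `bad`: for closed walks by `walkMoment_eq_ncSum_or`, and for
other walks because both are zero. On `bad` the difference is bounded uniformly in `n`. -/
theorem exists_norm_sum_walkMoment_sub_le (hx : IsInput P x) (hy : IsInput P y)
    (hxy : IndepFun (fun ω α => x α ω) (fun ω α => y α ω) P) (w : ℕ → StarVar) (m : ℕ) :
    ∃ C : ℝ, 0 ≤ C ∧ ∀ n : ℕ, ‖(∑ p : Fin (m + 1) → Fin n,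
        if vertexSeq p m = vertexSeq p 0 then walkMoment w p P x y else 0) -
      ∑ p : Fin (m + 1) → Fin n, ncSum (stepWeight w (vertexSeq p)) 0 m‖ ≤
        C * (n * (2 * n + 1) ^ ((m - 1) / 2)) := by
  classical
  obtain ⟨Cx, hCx0, hCx⟩ := hx.exists_bound w m
  obtain ⟨Cy, hCy0, hCy⟩ := hy.exists_bound w m
  set N : ℝ := ncSum (fun _ _ => (1 : ℝ)) 0 m with hN
  have hNle : ∀ {n : ℕ} (p : Fin (m + 1) → Fin n),
      ‖ncSum (stepWeight w (vertexSeq p)) 0 m‖ ≤ N := fun p =>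
    norm_ncSum_le _ (fun s t => by rw [stepWeight]; split_ifs <;> simp) 0 m
  have hN0 : 0 ≤ N := (norm_nonneg _).trans (norm_ncSum_le (fun _ _ => 0) (by simp) 0 m)
  set K := Fintype.card ((Fin m → Fin m) × Option (Fin m × Option (Fin m × Fin m))) with hK
  refine ⟨(Cx * Cy + N) * K, by positivity, fun n => ?_⟩
  set bad : Finset (Fin (m + 1) → Fin n) := Finset.univ.filter fun p =>
    ∃ g k, RelationHolds (fun t : Fin m => toeplitzLabel w p t) (walkRelation w) g k with hbad
  have hcard : (bad.card : ℝ) ≤ K * (n * (2 * n + 1) ^ ((m - 1) / 2)) := by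
    exact_mod_cast card_le_of_relationHolds (fun p (t : Fin m) => toeplitzLabel w p t)
      (fun p t => abs_toeplitzLabel w p t) (fun p p' => eq_of_toeplitzLabel_eq w p p')
      (walkRelation w) bad fun p hp => (Finset.mem_filter.1 hp).2
  rw [← Finset.sum_sub_distrib]
  have hzero : ∀ p ∉ bad, (if vertexSeq p m = vertexSeq p 0 then walkMoment w p P x y else 0) -
      ncSum (stepWeight w (vertexSeq p)) 0 m = 0 := by
    intro p hp
    have hp' : ¬ ∃ g k, RelationHolds (fun t : Fin m => toeplitzLabel w p t) (walkRelation w) g k :=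
      fun h => hp (Finset.mem_filter.2 ⟨Finset.mem_univ _, h⟩)
    split_ifs with hc
    · rw [(walkMoment_eq_ncSum_or w p hx hy hxy hc).resolve_right hp', sub_self]
    · rw [zero_sub, neg_eq_zero]
      by_contra h
      exact hc (eq_of_ncSum_stepWeight_ne_zero w _ 0 m (Nat.zero_le _) h).symm
  rw [← Finset.sum_subset (Finset.subset_univ bad) fun p _ hp => hzero p hp]
  calc ‖∑ p ∈ bad, ((if vertexSeq p m = vertexSeq p 0 then walkMoment w p P x y else 0) -
          ncSum (stepWeight w (vertexSeq p)) 0 m)‖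
      ≤ ∑ p ∈ bad, (Cx * Cy + N) := by
        refine norm_sum_le_of_le _ fun p _ => (norm_sub_le _ _).trans (add_le_add ?_ (hNle p))
        split_ifs
        · rw [walkMoment, integral_prod_eval_mul hx hy hxy w m, norm_mul]
          exact mul_le_mul (hCx _) (hCy _) (norm_nonneg _) hCx0
        · rw [norm_zero]
          positivity
    _ = (Cx * Cy + N) * bad.card := by rw [Finset.sum_const, nsmul_eq_mul, mul_comm]
    _ ≤ (Cx * Cy + N) * K * (n * (2 * n + 1) ^ ((m - 1) / 2)) := by
        rw [mul_assoc]
        gcongr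

theorem tendsto_normalizedTrace_prod [IsProbabilityMeasure P] (hx : IsInput P x) (hy : IsInput P y)
    (hxy : IndepFun (fun ω α => x α ω) (fun ω α => y α ω) P) (w : ℕ → StarVar) (m : ℕ) :
    Tendsto (fun n => normalizedTrace P n
        ((List.range m).map fun t => (w t).eval (scaledProduct P x y hx hy n)).prod) atTop
      (𝓝 (ncSum (fun s t => if (w s).sign + (w t).sign = 0 then 1 else 0) 0 m)) := by
  -- For the empty word the truncated exponent `(m - 1) / 2` is `0` and the error bound would not
  -- decay.
  rcases Nat.eq_zero_or_pos m with rfl | hm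
  · refine tendsto_const_nhds.congr' ?_
    filter_upwards [eventually_ge_atTop 1] with n hn
    rw [List.range_zero, List.map_nil, List.prod_nil, ncSum_of_le _ le_rfl]
    exact (isStarState_normalizedTrace P n hn).map_one.symm
  obtain ⟨C, hC0, hC⟩ := exists_norm_sum_walkMoment_sub_le hx hy hxy w m
  rw [tendsto_iff_norm_sub_tendsto_zero]
  have hlim : Tendsto (fun n : ℕ => C * 3 ^ ((m - 1) / 2) * (Real.sqrt n)⁻¹) atTop (𝓝 0) := by
    rw [← mul_zero (C * 3 ^ ((m - 1) / 2))]
    exact ((Real.tendsto_sqrt_atTop.comp tendsto_natCast_atTop_atTop).inv_tendsto_atTop).const_mul _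
  refine squeeze_zero' (Eventually.of_forall fun _ => norm_nonneg _) ?_ hlim
  filter_upwards [eventually_ge_atTop 1] with n hn
  have hn1 : (1 : ℝ) ≤ n := by exact_mod_cast hn
  set r : ℝ := Real.sqrt n with hr
  have hrr : r * r = n := Real.mul_self_sqrt (by positivity)
  have hr1 : 1 ≤ r := by rw [hr, Real.one_le_sqrt]; exact hn1
  have hr0 : 0 < r := by linarith
  have hrc : (r : ℂ) ≠ 0 := by exact_mod_cast hr0.ne'
  have hrrc : (r : ℂ) * r = n := by exact_mod_cast hrr
  set S := ∑ p : Fin (m + 1) → Fin n,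
    if vertexSeq p m = vertexSeq p 0 then walkMoment w p P x y else 0 with hS
  set T := ∑ p : Fin (m + 1) → Fin n, ncSum (stepWeight w (vertexSeq p)) 0 m with hT
  set c := ncSum (fun s t => if (w s).sign + (w t).sign = 0 then (1 : ℂ) else 0) 0 m with hc
  have hTc : (r : ℂ) ^ m * T = c * (n : ℂ) ^ (m + 1) := by
    have := sum_mul_ncSum_stepWeight (V := Fin n) w m r (by simpa using hrrc) 0 m (Nat.zero_le _)
      le_rfl (fun _ => 1) (fun _ _ _ _ _ => rfl)
    simpa using this
  -- The main term equals the limit exactly for each `n ≥ 1`, so only the error `S - T` has to be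
  -- estimated.
  have hmain : (n : ℂ)⁻¹ * ((r : ℂ)⁻¹ ^ m * T) = c := by
    have h1 : T = c * (r : ℂ) ^ (m + 2) := by
      have h2 : (r : ℂ) ^ m * T = (r : ℂ) ^ m * (c * (r : ℂ) ^ (m + 2)) := by
        rw [hTc, ← hrrc]
        ring
      exact mul_left_cancel₀ (pow_ne_zero _ hrc) h2
    rw [h1, ← hrrc, inv_pow]
    field_simp
    ring
  rw [normalizedTrace_prod_scaledProduct, ← hS]
  have e : (n : ℂ)⁻¹ * ((r : ℂ)⁻¹ ^ m * S) - c = (n : ℂ)⁻¹ * ((r : ℂ)⁻¹ ^ m * (S - T)) := by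
    rw [mul_sub, mul_sub, hmain]
  rw [e, norm_mul, norm_mul, norm_inv, norm_pow, norm_inv, Complex.norm_natCast, Complex.norm_real,
    Real.norm_of_nonneg hr0.le]
  -- Since `2 * ((m - 1) / 2) ≤ m - 1`, the error retains at least one factor `r⁻¹`, that is `n ^
  -- (-1/2)`.
  have hd : (2 * (n : ℝ) + 1) ^ ((m - 1) / 2) ≤ 3 ^ ((m - 1) / 2) * r ^ (m - 1) := by
    calc (2 * (n : ℝ) + 1) ^ ((m - 1) / 2) ≤ (3 * (r * r)) ^ ((m - 1) / 2) := by
          rw [hrr]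
          gcongr
          linarith
      _ = 3 ^ ((m - 1) / 2) * r ^ (2 * ((m - 1) / 2)) := by rw [mul_pow, ← pow_two, ← pow_mul]
      _ ≤ 3 ^ ((m - 1) / 2) * r ^ (m - 1) := by
          gcongr
          omega
  calc (n : ℝ)⁻¹ * (r⁻¹ ^ m * ‖S - T‖)
      ≤ (n : ℝ)⁻¹ * (r⁻¹ ^ m * (C * (n * (3 ^ ((m - 1) / 2) * r ^ (m - 1))))) := by
        have := hC n
        rw [← hS, ← hT] at this
        gcongr
        exact this.trans (by gcongr)
    _ = C * 3 ^ ((m - 1) / 2) * r⁻¹ := by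
        obtain ⟨k, rfl⟩ : ∃ k, m = k + 1 := ⟨m - 1, by omega⟩
        have hn0 : (n : ℝ) ≠ 0 := by positivity
        rw [Nat.add_sub_cancel, pow_succ, inv_pow]
        field_simp

theorem convergesInStarDistribution_circ [IsProbabilityMeasure P] (hx : IsInput P x)
    (hy : IsInput P y) (hxy : IndepFun (fun ω α => x α ω) (fun ω α => y α ω) P) :
    ConvergesInStarDistribution (fun n => normalizedTrace P n)
      (fun n => scaledProduct P x y hx hy n) Fock.vacuum Fock.circ := by
  refine convergesInStarDistribution_of_words _ _ _ _ fun w m => ?_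
  rw [Fock.vacuum_prod_circ]
  exact tendsto_normalizedTrace_prod hx hy hxy w m

/-! ### The number of random variables involved -/

theorem card_usedIndices_toeplitzLink (n : ℕ) (hn : 1 ≤ n) :
    (usedIndices toeplitzLink n).card = 2 * n - 1 := by
  have : usedIndices toeplitzLink n = Finset.Icc (1 - (n : ℤ)) (n - 1) := by
    ext a
    simp only [usedIndices, toeplitzLink, Finset.mem_image, Finset.mem_product, Finset.mem_Icc,
      Prod.exists]
    constructor
    · rintro ⟨i, j, h, rfl⟩
      omega
    · rintro ⟨h1, h2⟩
      -- Nonnegative differences occur in the first column, the others in the first row.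
      rcases le_total 0 a with h | h
      · exact ⟨(a + 1).toNat, 1, by omega, by omega⟩
      · exact ⟨1, (1 - a).toNat, by omega, by omega⟩
  rw [this, Int.card_Icc]
  omega

theorem card_usedIndices_hankelLink (n : ℕ) (hn : 1 ≤ n) :
    (usedIndices hankelLink n).card = 2 * n - 1 := by
  have : usedIndices hankelLink n = Finset.Icc 2 (2 * (n : ℤ)) := by
    ext a
    simp only [usedIndices, hankelLink, Finset.mem_image, Finset.mem_product, Finset.mem_Icc,
      Prod.exists]
    constructor
    · rintro ⟨i, j, h, rfl⟩
      omega
    · rintro ⟨h1, h2⟩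
      -- Sums up to `n + 1` occur in the first column, the larger ones in the last row.
      rcases le_total a (n + 1) with h | h
      · exact ⟨(a - 1).toNat, 1, by omega, by omega⟩
      · exact ⟨n, (a - n).toNat, by omega, by omega⟩
  rw [this, Int.card_Icc]
  omega

end RandomMatrix

end

theorem theorem3 {Ω : Type*} [MeasurableSpace Ω] (P : Measure Ω) [IsProbabilityMeasure P]
    (x y : ℤ → Ω → ℂ) (hx : RandomMatrix.IsInput P x) (hy : RandomMatrix.IsInput P y)
    (hxy : IndepFun (fun ω α => x α ω) (fun ω α => y α ω) P) :
    -- there is a circular variable to which the sequence converges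
    (∃ (A : Type) (_ : Ring A) (_ : StarRing A) (_ : Algebra ℂ A) (_ : StarModule ℂ A)
      (φ : A →ₗ[ℂ] ℂ) (c : A), FreeProb.IsStarState φ ∧ FreeProb.IsCircular φ c ∧
        FreeProb.ConvergesInStarDistribution (fun n => RandomMatrix.normalizedTrace P n)
          (fun n => RandomMatrix.scaledProduct P x y hx hy n) φ c) ∧
    -- and the same holds for any circular variable in any star-probability space
    (∀ (A : Type*) [Ring A] [StarRing A] [Algebra ℂ A] [StarModule ℂ A]
      (φ : A →ₗ[ℂ] ℂ) (c : A), FreeProb.IsStarState φ → FreeProb.IsCircular φ c →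
        FreeProb.ConvergesInStarDistribution (fun n => RandomMatrix.normalizedTrace P n)
          (fun n => RandomMatrix.scaledProduct P x y hx hy n) φ c) ∧
    -- the size `n` matrix is built from `4n - 2` scalar random variables only
    (∀ n : ℕ, 1 ≤ n →
      (RandomMatrix.usedIndices RandomMatrix.toeplitzLink n).card +
        (RandomMatrix.usedIndices RandomMatrix.hankelLink n).card = 4 * n - 2) := by
  refine ⟨⟨FreeProb.Fock.Space →L[ℂ] FreeProb.Fock.Space, inferInstance, inferInstance,
    inferInstance, inferInstance, FreeProb.Fock.vacuum, FreeProb.Fock.circ,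
    FreeProb.Fock.isStarState_vacuum, FreeProb.Fock.isCircular_circ,
    RandomMatrix.convergesInStarDistribution_circ hx hy hxy⟩, ?_, fun n hn => ?_⟩
  · intro A _ _ _ _ φ c hφ hc Q
    rw [hc.starDistribution_eq hφ.map_one FreeProb.Fock.vacuum_one FreeProb.Fock.isCircular_circ]
    exact RandomMatrix.convergesInStarDistribution_circ hx hy hxy Q
  · rw [RandomMatrix.card_usedIndices_toeplitzLink n hn,
      RandomMatrix.card_usedIndices_hankelLink n hn]
    omega
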